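/- Let $(\phi_j)_{j\ge1}$ be an orthonormal basis of $L_2(0,1)$ and let $w$ be the Wiener process. For $\varepsilon>0$ one observes $dY_\varepsilon(t)=S(t)\,dt+\varepsilon\,dw(t)$, $t\in(0,1)$, $S\in L_2(0,1)$. Put $\theta_j=\int_0^1S\phi_j\,dt$ and $y_{\varepsilon j}=\int_0^1\phi_j\,dY_\varepsilon=\theta_j+\varepsilon\xi_j$ with $\xi_j=\int_0^1\phi_j\,dw$. For real coefficients $\varkappa_{\varepsilon j}$ with $\rho_\varepsilon^2=\sum_{j\ge1}\varkappa_{\varepsilon j}^2<\infty$ let $$A_\varepsilon=\varepsilon^{-4}\sum_{j\ge1}\varkappa_{\varepsilon j}^4,\qquad T_\varepsilon=\varepsilon^{-2}\sum_{j\ge1}\varkappa_{\varepsilon j}^2y_{\varepsilon j}^2-\rho_\varepsilon^2,\qquad k_\varepsilon=\sup\Big\{k\ge 1:\sum_{1\le j<k}\varkappa_{\varepsilon j}^2\le\tfrac12\rho_\varepsilon^2\Big\},\qquad \varkappa_\varepsilon^2=\varkappa_{\varepsilon k_\varepsilon}^2 .$$ The tests considered are $L_\varepsilon=\mathbf 1\{A_\varepsilon^{-1/2}T_\varepsilon>x_\varepsilon\}$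 with arbitrary critical values $x_\varepsilon\in\mathbb R$; $\alpha(L_\varepsilon)=\mathbf E_0L_\varepsilon$ and $\beta(L_\varepsilon,S)=\mathbf E_S(1-L_\varepsilon)$ are their error probabilities. Write $a_\varepsilon\asymp b_\varepsilon$ if $a_\varepsilon/b_\varepsilon$ lies between two positive constants for all sufficiently small $\varepsilon>0$, and $[a]$ for the integer part of $a$. Assume: A1. For each $\varepsilon>0$ the sequence $(\varkappa_{\varepsilon j}^2)_{j\ge1}$ is nonincreasing. A2. There are constants $0<c<C$ with $c<A_\varepsilon<C$ for all $\varepsilon>0$. A3. There are $C>0$ and $\lambda>1$ with $\varkappa^2_{\varepsilon,[(1+\delta)k_\varepsilon]}<C(1+\delta)^{-\lambda}\varkappa_\varepsilon^2$ for all $\delta>0$ and $\varepsilon>0$. A4. $\varkappa_{\varepsilon1}^2\asymp\varkappa_\varepsilon^2$ as $\varepsilon\to0$, and for every $c>1$ there is $C>0$ with $\varkappa^2_{\varepsilon,[ck_\varepsilon]}\ge C\varkappa_\varepsilon^2$ for all $\varepsilon>0$. Let $0<r<1/2$, $0<2\omega<1-2r$ and $k_\varepsilon\asymp\varepsilon^{-4+8r+4\omega}$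 as $\varepsilon\to0$. A family of alternatives $S_\varepsilon\in L_2(0,1)$, $\varepsilon>0$, is called $\varepsilon^{-2\omega}$-LD consistent if for all tests $L_\varepsilon$ as above with $\varepsilon^{4\omega}\log\alpha(L_\varepsilon)\to0$ as $\varepsilon\to0$ there is $c>0$ with $|\log\beta(L_\varepsilon,S_\varepsilon)|\ge c\,\varepsilon^{-4\omega}$ for all small $\varepsilon$ (with $|\log 0|=\infty$). The same definition applies to sequences $S_{1\varepsilon_i}$ with $\varepsilon_i>0$, $\varepsilon_i\to0$ as $i\to\infty$; a family or sequence that is not consistent is called inconsistent. A consistent family $S_\varepsilon$ with $\|S_\varepsilon\|\asymp\varepsilon^{2r}$ is called purely $\varepsilon^{-2\omega}$-LD consistent if there is no inconsistent sequence $S_{1\varepsilon_i}$, $\varepsilon_i\to0$, such that $S_{1\varepsilon_i}$ is orthogonal to $S_{\varepsilon_i}-S_{1\varepsilon_i}$ and $\|S_{1\varepsilon_i}\|>c_1\varepsilon_i^{2r}$ for all $i$ with some constant $c_1>0$. **Theorem.** Let $S_\varepsilon\in L_2(0,1)$, $\varepsilon>0$, be a family with $\|S_\varepsilon\|\asymp\varepsilon^{2r}$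 as $\varepsilon\to0$, and let $\theta_{\varepsilon j}=\int_0^1S_\varepsilon\phi_j\,dt$. Then $S_\varepsilon$ is purely $\varepsilon^{-2\omega}$-LD consistent if and only if for every $\delta>0$ there are $C_1=C_1(\delta)>0$ and $\varepsilon_0=\varepsilon_0(\delta)>0$ such that $$\sum_{j>C_1k_\varepsilon}|\theta_{\varepsilon j}|^2\le\delta\,\varepsilon^{4r}\qquad\text{for all }0<\varepsilon<\varepsilon_0 .$$ -/

import Mathlib

open Filter Topology Asymptotics MeasureTheory ProbabilityTheory

noncomputable section

namespace SignalDetection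

/-- The real Hilbert space `L₂(0,1)`. -/
abbrev L2 : Type := Lp ℝ 2 (volume.restrict (Set.Ioo (0 : ℝ) 1))

/-- Gaussian white noise on `(0,1)` over the probability space `(Ω, P)`, given through its
stochastic integrals: `W f` stands for `∫₀¹ f dw`. It is a centred Gaussian process indexed by
`L₂(0,1)` whose covariance is the inner product. -/
structure IsWhiteNoise {Ω : Type*} [MeasurableSpace Ω] (P : Measure Ω) (W : L2 → Ω → ℝ) :
    Prop where
  isGaussianProcess : IsGaussianProcess W P
  mean_eq_zero : ∀ f, ∫ ω, W f ω ∂P = 0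
  covariance_eq : ∀ f g, cov[W f, W g; P] = inner ℝ f g

/-! ### The coefficients of the test statistics

`ϰ ε j` is the coefficient with index `j ≥ 1` at noise level `ε`; the value `ϰ ε 0` is never
used. -/

/-- `ρ_ε² = ∑_{j ≥ 1} ϰ_{εj}²`. -/
def rhoSq (ϰ : ℝ → ℕ → ℝ) (ε : ℝ) : ℝ := ∑' j : ℕ+, ϰ ε j ^ 2

/-- `A_ε = ε⁻⁴ ∑_{j ≥ 1} ϰ_{εj}⁴`. -/
def bigA (ϰ : ℝ → ℕ → ℝ) (ε : ℝ) : ℝ := (ε ^ 4)⁻¹ * ∑' j : ℕ+, ϰ ε j ^ 4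

/-- `k_ε = sup {k ≥ 1 : ∑_{1 ≤ j < k} ϰ_{εj}² ≤ ρ_ε² / 2}`. -/
def kIdx (ϰ : ℝ → ℕ → ℝ) (ε : ℝ) : ℕ :=
  sSup {k : ℕ | 1 ≤ k ∧ ∑ j ∈ Finset.Ico 1 k, ϰ ε j ^ 2 ≤ rhoSq ϰ ε / 2}

/-- `ϰ_ε² = ϰ_{ε k_ε}²`. -/
def kappaSq (ϰ : ℝ → ℕ → ℝ) (ε : ℝ) : ℝ := ϰ ε (kIdx ϰ ε) ^ 2

/-- A1: for each `ε > 0` the sequence `ϰ_{εj}²`, `j ≥ 1`, is decreasing (not necessarily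
strictly). -/
def A1 (ϰ : ℝ → ℕ → ℝ) : Prop :=
  ∀ ε > 0, AntitoneOn (fun j : ℕ => ϰ ε j ^ 2) (Set.Ici 1)

/-- A2: `C₁ < A_ε < C₂` for all `ε > 0`, with positive constants. -/
def A2 (ϰ : ℝ → ℕ → ℝ) : Prop :=
  ∃ C₁ > 0, ∃ C₂ > 0, ∀ ε > 0, C₁ < bigA ϰ ε ∧ bigA ϰ ε < C₂

/-- A3: there are `C₁` and `lam > 1` with
`ϰ²_{ε, [(1+δ) k_ε]} < C₁ (1+δ)^{-lam} ϰ_ε²` for all `δ > 0` and all `ε > 0`. -/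
def A3 (ϰ : ℝ → ℕ → ℝ) : Prop :=
  ∃ C₁ > 0, ∃ lam > (1 : ℝ), ∀ δ > (0 : ℝ), ∀ ε > 0,
    ϰ ε ⌊(1 + δ) * (kIdx ϰ ε : ℝ)⌋₊ ^ 2 < C₁ * (1 + δ) ^ (-lam) * kappaSq ϰ ε

/-- A4: `ϰ_{ε1}² ≍ ϰ_ε²` as `ε → 0`, and for each `c > 1` there is `C > 0` with
`ϰ²_{ε, [c k_ε]} ≥ C ϰ_ε²` for all `ε > 0`. -/
def A4 (ϰ : ℝ → ℕ → ℝ) : Prop :=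
  ((fun ε => ϰ ε 1 ^ 2) =Θ[𝓝[>] 0] fun ε => kappaSq ϰ ε) ∧
  ∀ c > (1 : ℝ), ∃ C > 0, ∀ ε > 0,
    C * kappaSq ϰ ε ≤ ϰ ε ⌊c * (kIdx ϰ ε : ℝ)⌋₊ ^ 2

/-! ### Observations, test statistics and tests -/

/-- The Fourier coefficient `θ_j = ∫₀¹ S φ_j dt`. -/
def fourier (φ : HilbertBasis ℕ+ ℝ L2) (S : L2) (j : ℕ+) : ℝ := inner ℝ (φ j) S

section Tests

variable {Ω : Type*} [MeasurableSpace Ω]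

/-- The observation `y_{εj} = ∫₀¹ φ_j dY_ε = θ_j + ε ξ_j`, where `dY_ε = S dt + ε dw` and
`ξ_j = ∫₀¹ φ_j dw`. -/
def obs (W : L2 → Ω → ℝ) (φ : HilbertBasis ℕ+ ℝ L2) (ε : ℝ) (S : L2) (j : ℕ+) (ω : Ω) : ℝ :=
  fourier φ S j + ε * W (φ j) ω

/-- The test statistic `T_ε(Y_ε) = ε⁻² ∑_j ϰ_{εj}² y_{εj}² - ρ_ε²` under the signal `S`. -/
def stat (W : L2 → Ω → ℝ) (φ : HilbertBasis ℕ+ ℝ L2) (ϰ : ℝ → ℕ → ℝ) (ε : ℝ) (S : L2)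
    (ω : Ω) : ℝ :=
  (ε ^ 2)⁻¹ * ∑' j : ℕ+, ϰ ε j ^ 2 * obs W φ ε S j ω ^ 2 - rhoSq ϰ ε

/-- The event that the test `L_ε = 1{A_ε^{-1/2} T_ε > x}` rejects, when the signal is `S`. -/
def rejects (W : L2 → Ω → ℝ) (φ : HilbertBasis ℕ+ ℝ L2) (ϰ : ℝ → ℕ → ℝ) (ε : ℝ) (S : L2)
    (x : ℝ) : Set Ω :=
  {ω | x < (bigA ϰ ε) ^ (-(1 / 2) : ℝ) * stat W φ ϰ ε S ω}

/-- Type I error probability `α(L_ε)` of the test with critical value `x`. -/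
def typeI (P : Measure Ω) (W : L2 → Ω → ℝ) (φ : HilbertBasis ℕ+ ℝ L2) (ϰ : ℝ → ℕ → ℝ)
    (ε x : ℝ) : ℝ :=
  P.real (rejects W φ ϰ ε 0 x)

/-- Type II error probability `β(L_ε, S)` of the test with critical value `x`. -/
def typeII (P : Measure Ω) (W : L2 → Ω → ℝ) (φ : HilbertBasis ℕ+ ℝ L2) (ϰ : ℝ → ℕ → ℝ)
    (ε : ℝ) (S : L2) (x : ℝ) : ℝ :=
  P.real (rejects W φ ϰ ε S x)ᶜ

/-- LD consistency at rate `R` of a collection of alternatives `S i`, observed at noise levels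
`e i`, along a filter `l`: for all tests (critical values `x i`) with `R⁻² log α → 0` one has
`R² = O(|log β|)`. Here `l = 𝓝[>] 0`, `e = id` is the case of a family indexed by `ε > 0`, and
`l = atTop` on `ℕ` that of a sequence. As `0 ≤ β ≤ 1`, the bound `c R² ≤ |log β|` is written
`β ≤ exp (-c R²)`, which also covers `β = 0`, `|log β| = ∞`. -/
def LDConsistent {ι : Type*} (P : Measure Ω) (W : L2 → Ω → ℝ) (φ : HilbertBasis ℕ+ ℝ L2)
    (ϰ : ℝ → ℕ → ℝ) (l : Filter ι) (e : ι → ℝ) (R : ι → ℝ) (S : ι → L2) : Prop :=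
  ∀ x : ι → ℝ,
    (∀ᶠ i in l, 0 < typeI P W φ ϰ (e i) (x i)) →
    Tendsto (fun i => (R i ^ 2)⁻¹ * Real.log (typeI P W φ ϰ (e i) (x i))) l (𝓝 0) →
    ∃ c > 0, ∀ᶠ i in l, typeII P W φ ϰ (e i) (S i) (x i) ≤ Real.exp (-(c * R i ^ 2))

/-- Pure `ε^{-2w}`-LD consistency of a family `S_ε` of order `ε^{2r}`: the family is
`ε^{-2w}`-LD consistent, and there is no inconsistent sequence of alternatives `S₁_{ε_i}`,
`ε_i → 0`, such that `S₁_{ε_i}` is orthogonal to `S_{ε_i} - S₁_{ε_i}` and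
`‖S₁_{ε_i}‖ > c₁ ε_i^{2r}` for some constant `c₁ > 0`. -/
def PurelyLDConsistent (P : Measure Ω) (W : L2 → Ω → ℝ) (φ : HilbertBasis ℕ+ ℝ L2)
    (ϰ : ℝ → ℕ → ℝ) (r w : ℝ) (S : ℝ → L2) : Prop :=
  LDConsistent P W φ ϰ (𝓝[>] (0 : ℝ)) (fun ε => ε) (fun ε => ε ^ (-2 * w)) S ∧
  ¬ ∃ (e : ℕ → ℝ) (S₁ : ℕ → L2),
      (∀ i, 0 < e i) ∧ Tendsto e atTop (𝓝 0) ∧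
      (∃ c₁ > 0, ∀ i, c₁ * e i ^ (2 * r) < ‖S₁ i‖) ∧
      (∀ i, inner ℝ (S₁ i) (S (e i) - S₁ i) = 0) ∧
      ¬ LDConsistent P W φ ϰ atTop e (fun i => e i ^ (-2 * w)) S₁

end Tests

end SignalDetection

end

/-!
The statistic `ε⁻² T_ε` is a centred weighted noncentral chi-square sum with mean
`A_ε(S) = ε⁻⁴ ∑ ϰ_{εj}² θ_j²` and, without signal, variance `2 A_ε`. At deviations of order
`R = ε^{-2ω}` the largest weight is `o(1/R)`, so Chernoff bounds from above and the Paley–Zygmund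
inequality for `exp (t ε⁻² T_ε)` from below have Gaussian exponents. Consequently alternatives are
consistent when `R = O(A_ε(S))`, and inconsistent when `A_ε(S) = o(R)`: the critical value
`2 A_ε(S) + O(1)` for `ε⁻² T_ε` then keeps `log α = o(R²)` and `β` away from `0`.

Summing the fourth powers of the coefficients gives `k_ε ϰ_ε⁴ ≍ ε⁴`, hence
`ϰ_ε² ε^{4r-4} ≍ R`. The weights `ϰ_{εj}²` are of order `ϰ_ε²` up to any fixed multiple of `k_ε` and
negligible compared with it far beyond, so a signal of norm `≍ ε^{2r}` is detected exactly through
its energy in the coordinates `j ≤ C k_ε`. If the tails of `S_ε` are negligible, a part of `S_ε` of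
order `ε^{2r}` that is orthogonal to the rest keeps energy there, since its inner product with `S_ε`
is its squared norm. Otherwise the tails themselves form an inconsistent sequence of orthogonal
parts.
-/

namespace SignalDetection

open Real
open scoped NNReal ENNReal

/-! ### Exponential moments of squared Gaussian variables -/

section GaussianSquares

variable {Ω : Type*} [MeasurableSpace Ω] {P : Measure Ω}

lemma gaussianPDFReal_mul_exp_mul_sq {v : ℝ≥0} (hv : v ≠ 0) {t : ℝ} (ht : 2 * v * t < 1)
    (μ x : ℝ) :
    gaussianPDFReal μ v x * exp (t * x ^ 2) =
      (√(1 - 2 * v * t))⁻¹ * exp (μ ^ 2 * t / (1 - 2 * v * t)) *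
        gaussianPDFReal (μ / (1 - 2 * v * t)) (v / (1 - 2 * v * t)).toNNReal x := by
  have hd : 0 < 1 - 2 * v * t := by linarith
  have hv₀ : (0 : ℝ) < v := by exact_mod_cast pos_iff_ne_zero.2 hv
  have hsqrt : √(2 * π * (v / (1 - 2 * v * t))) = √(2 * π * v) * (√(1 - 2 * v * t))⁻¹ := by
    rw [← mul_div_assoc, sqrt_div (by positivity), div_eq_mul_inv]
  have hexponent : -(x - μ) ^ 2 / (2 * v) + t * x ^ 2 =
      μ ^ 2 * t / (1 - 2 * v * t) +
        -(x - μ / (1 - 2 * v * t)) ^ 2 / (2 * (v / (1 - 2 * v * t))) := by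
    have := hd.ne'
    field_simp
    ring
  rw [gaussianPDFReal, gaussianPDFReal, coe_toNNReal _ (by positivity), hsqrt, mul_assoc,
    ← exp_add, hexponent, exp_add]
  have := (sqrt_pos.2 hd).ne'
  field_simp

lemma mgf_sq_gaussianReal (μ : ℝ) (v : ℝ≥0) {t : ℝ} (ht : 2 * v * t < 1) :
    mgf (fun x => x ^ 2) (gaussianReal μ v) t =
      (√(1 - 2 * v * t))⁻¹ * exp (μ ^ 2 * t / (1 - 2 * v * t)) := by
  obtain rfl | hv := eq_or_ne v 0
  · simp [mgf, mul_comm t]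
  have hd : 0 < 1 - 2 * v * t := by linarith
  have hv' : (v / (1 - 2 * v * t)).toNNReal ≠ 0 :=
    (toNNReal_pos.2 (div_pos (by exact_mod_cast pos_iff_ne_zero.2 hv) hd)).ne'
  rw [mgf, integral_gaussianReal_eq_integral_smul hv]
  simp_rw [smul_eq_mul, gaussianPDFReal_mul_exp_mul_sq hv ht]
  rw [integral_const_mul, integral_gaussianPDFReal_eq_one _ hv', mul_one]

lemma mgf_sq_sub_one {η : Ω → ℝ} {a : ℝ} (hη : HasLaw η (gaussianReal a 1) P) {t : ℝ}
    (ht : 2 * t < 1) :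
    mgf (fun ω => η ω ^ 2 - 1) P t =
      exp (-(log (1 - 2 * t) / 2) - t + a ^ 2 * t / (1 - 2 * t)) := by
  have hsq : mgf (fun ω => η ω ^ 2) P t = mgf (fun x => x ^ 2) (gaussianReal a 1) t := by
    rw [← hη.map_eq, mgf_map hη.aemeasurable (by fun_prop)]
    rfl
  have hsqrt : (√(1 - 2 * t))⁻¹ = exp (-(log (1 - 2 * t) / 2)) := by
    rw [exp_neg, exp_half, exp_log (by linarith)]
  simp_rw [sub_eq_add_neg (_ ^ 2)]
  rw [mgf_add_const, hsq, mgf_sq_gaussianReal a 1 (by simpa using ht), NNReal.coe_one, mul_one,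
    hsqrt, ← exp_add, ← exp_add]
  ring_nf

lemma neg_log_one_sub_div_two_sub_le {t : ℝ} (ht : |t| ≤ 1 / 8) :
    -(log (1 - 2 * t) / 2) - t ≤ 4 * t ^ 2 := by
  obtain ⟨-, h₂⟩ := abs_le.1 ht
  have hd : 0 < 1 - 2 * t := by linarith
  have hlog := one_sub_inv_le_log_of_pos hd
  have hinv : (1 - 2 * t)⁻¹ ≤ 1 + 2 * t + 8 * t ^ 2 := by
    rw [inv_le_iff_one_le_mul₀ hd]
    nlinarith [sq_nonneg t]
  linarith

lemma sq_le_neg_log_one_sub_div_two_sub {t : ℝ} (ht₀ : 0 ≤ t) (ht : 2 * t < 1) :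
    t ^ 2 ≤ -(log (1 - 2 * t) / 2) - t := by
  have hlog := hasSum_pow_div_log_of_abs_lt_one (x := 2 * t) (by rwa [abs_of_nonneg (by linarith)])
  have hpartial := sum_le_hasSum (Finset.range 2) (fun i _ => by positivity) hlog
  norm_num [Finset.sum_range_succ] at hpartial
  linarith

lemma mul_div_one_sub_two_mul_le {t : ℝ} (ht : |t| ≤ 1 / 8) :
    t / (1 - 2 * t) ≤ t + |t| / 2 := by
  obtain ⟨h₁, h₂⟩ := abs_le.1 ht
  rw [div_le_iff₀ (by linarith)]
  cases abs_cases t <;> nlinarith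

lemma mgf_sq_sub_one_le {η : Ω → ℝ} {a : ℝ} (hη : HasLaw η (gaussianReal a 1) P) {t : ℝ}
    (ht : |t| ≤ 1 / 8) :
    mgf (fun ω => η ω ^ 2 - 1) P t ≤ exp (4 * t ^ 2 + (t + |t| / 2) * a ^ 2) := by
  rw [mgf_sq_sub_one hη (by linarith [(abs_le.1 ht).2])]
  gcongr
  · exact neg_log_one_sub_div_two_sub_le ht
  · rw [mul_div_assoc, mul_comm]
    gcongr
    exact mul_div_one_sub_two_mul_le ht

lemma exp_sq_le_mgf_sq_sub_one {η : Ω → ℝ} {a : ℝ} (hη : HasLaw η (gaussianReal a 1) P) {t : ℝ}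
    (ht₀ : 0 ≤ t) (ht : 2 * t < 1) :
    exp (t ^ 2) ≤ mgf (fun ω => η ω ^ 2 - 1) P t := by
  rw [mgf_sq_sub_one hη ht]
  gcongr
  have hlog := sq_le_neg_log_one_sub_div_two_sub ht₀ ht
  have hshift : 0 ≤ a ^ 2 * t / (1 - 2 * t) := div_nonneg (by positivity) (by linarith)
  linarith

lemma sq_setIntegral_le_integral_sq_mul_measureReal [IsFiniteMeasure P] {X : Ω → ℝ}
    (hX : MemLp X 2 P) {A : Set Ω} (hA : NullMeasurableSet A P) :
    (∫ ω in A, X ω ∂P) ^ 2 ≤ (∫ ω, X ω ^ 2 ∂P) * P.real A := by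
  have hsq : ∀ s : ℝ, Integrable (fun ω => s ^ 2 * X ω ^ 2) P := fun s =>
    hX.integrable_sq.const_mul _
  have hind : ∀ s : ℝ, Integrable (fun ω => 2 * s * A.indicator X ω) P := fun s =>
    ((hX.integrable one_le_two).indicator₀ hA).const_mul _
  have hone : Integrable (A.indicator fun _ => (1 : ℝ)) P :=
    (integrable_const 1).indicator₀ hA
  have hquad : ∀ s : ℝ,
      0 ≤ (∫ ω, X ω ^ 2 ∂P) * (s * s) + (-2 * ∫ ω in A, X ω ∂P) * s + P.real A := by
    intro s
    have hexpand : ∀ ω, (s * X ω - A.indicator (fun _ => 1) ω) ^ 2 =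
        s ^ 2 * X ω ^ 2 - 2 * s * A.indicator X ω + A.indicator (fun _ => (1 : ℝ)) ω := by
      intro ω
      by_cases hω : ω ∈ A <;> simp [hω] <;> ring
    have hnonneg : 0 ≤ ∫ ω, (s * X ω - A.indicator (fun _ => 1) ω) ^ 2 ∂P :=
      integral_nonneg fun ω => sq_nonneg _
    simp_rw [hexpand] at hnonneg
    rw [integral_add (by fun_prop) hone, integral_sub (hsq s) (hind s),
      integral_const_mul, integral_const_mul, integral_indicator₀ hA, integral_indicator₀ hA,
      setIntegral_const, smul_eq_mul, mul_one] at hnonneg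
    linarith
  have := discrim_le_zero hquad
  rw [discrim] at this
  linarith

lemma paley_zygmund [IsProbabilityMeasure P] {X : Ω → ℝ} (hX₀ : 0 ≤ᵐ[P] X) (hX : MemLp X 2 P)
    {θ : ℝ} (hθ₀ : 0 ≤ θ) (hθ₁ : θ ≤ 1) :
    (1 - θ) ^ 2 * (∫ ω, X ω ∂P) ^ 2 ≤
      (∫ ω, X ω ^ 2 ∂P) * P.real {ω | θ * ∫ ω', X ω' ∂P < X ω} := by
  set m := ∫ ω, X ω ∂P
  set A := {ω | θ * m < X ω}
  have hA : NullMeasurableSet A P := nullMeasurableSet_lt aemeasurable_const hX.aemeasurable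
  have hm : 0 ≤ m := integral_nonneg_of_ae hX₀
  have hlow : (1 - θ) * m ≤ ∫ ω in A, X ω ∂P := by
    have hXint : Integrable X P := hX.integrable one_le_two
    have hle : m ≤ ∫ ω, A.indicator X ω + θ * m ∂P := by
      refine integral_mono hXint ((hXint.indicator₀ hA).add (integrable_const _)) fun ω => ?_
      by_cases hω : ω ∈ A
      · simpa [hω] using mul_nonneg hθ₀ hm
      · simpa [hω] using not_lt.1 hω
    rw [integral_add (hXint.indicator₀ hA) (integrable_const _), integral_indicator₀ hA] at hle
    simp only [integral_const, probReal_univ, one_smul] at hle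
    linarith
  calc (1 - θ) ^ 2 * m ^ 2 = ((1 - θ) * m) ^ 2 := by ring
    _ ≤ (∫ ω in A, X ω ∂P) ^ 2 := by
      have : 0 ≤ 1 - θ := sub_nonneg.2 hθ₁
      gcongr
    _ ≤ (∫ ω, X ω ^ 2 ∂P) * P.real A := sq_setIntegral_le_integral_sq_mul_measureReal hX hA

end GaussianSquares

/-! ### Deviations of weighted chi-square sums -/

section QuadraticForms

variable {Ω ι : Type*} {q a : ι → ℝ} {η : ι → Ω → ℝ}

/-- The finite centred quadratic form `∑_{i ∈ F} q_i (η_i² - 1)`. -/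
noncomputable def partialQuad (q : ι → ℝ) (η : ι → Ω → ℝ) (F : Finset ι) (ω : Ω) : ℝ :=
  ∑ i ∈ F, q i * (η i ω ^ 2 - 1)

/-- The centred quadratic form `∑ q_i (η_i² - 1)`; the two series are summed separately, as in the
test statistic. -/
noncomputable def quadForm (q : ι → ℝ) (η : ι → Ω → ℝ) (ω : Ω) : ℝ :=
  ∑' i, q i * η i ω ^ 2 - ∑' i, q i

lemma tendsto_partialQuad {ω : Ω} (hq : Summable q) (hη : Summable fun i => q i * η i ω ^ 2) :
    Tendsto (fun F => partialQuad q η F ω) atTop (𝓝 (quadForm q η ω)) := by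
  refine (hη.hasSum.sub hq.hasSum).congr fun F => Finset.sum_congr rfl fun i _ => ?_
  ring

variable [MeasurableSpace Ω] {P : Measure Ω}

lemma aemeasurable_partialQuad (hη : ∀ i, AEMeasurable (η i) P) (F : Finset ι) :
    AEMeasurable (partialQuad q η F) P := by
  unfold partialQuad
  fun_prop

lemma sq_mgf_le_mul_measureReal [IsProbabilityMeasure P] {X : Ω → ℝ} {t : ℝ}
    (hX : Integrable (fun ω => exp (2 * t * X ω)) P) :
    1 / 4 * mgf X P t ^ 2 ≤ mgf X P (2 * t) * P.real {ω | mgf X P t / 2 < exp (t * X ω)} := by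
  have hsq : ∀ ω, exp (t * X ω) ^ 2 = exp (2 * t * X ω) := fun ω => by
    rw [← exp_nat_mul]
    ring_nf
  have hmeas : AEMeasurable (fun ω => exp (t * X ω)) P := by
    simpa only [← hsq, sqrt_sq (exp_pos _).le] using hX.aemeasurable.sqrt
  have hmem : MemLp (fun ω => exp (t * X ω)) 2 P := by
    simpa only [memLp_two_iff_integrable_sq hmeas.aestronglyMeasurable, hsq] using hX
  have hpz := paley_zygmund (ae_of_all P fun ω => (exp_pos _).le) hmem (θ := 1 / 2)
    (by norm_num) (by norm_num)
  simp only [hsq] at hpz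
  norm_num at hpz ⊢
  simpa only [mgf, div_eq_inv_mul, mul_one] using hpz

lemma mgf_partialQuad (hind : iIndepFun η P) (hη : ∀ i, AEMeasurable (η i) P)
    (F : Finset ι) (t : ℝ) :
    mgf (partialQuad q η F) P t = ∏ i ∈ F, mgf (fun ω => η i ω ^ 2 - 1) P (q i * t) := by
  have hsum : partialQuad q η F = ∑ i ∈ F, fun ω => q i * (η i ω ^ 2 - 1) := by
    ext ω
    simp [partialQuad]
  have hind' : iIndepFun (fun i ω => q i * (η i ω ^ 2 - 1)) P :=
    hind.comp (fun i x => q i * (x ^ 2 - 1)) fun i => by fun_prop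
  rw [hsum, hind'.mgf_sum₀ fun i => by fun_prop]
  simp only [mgf_const_mul]

section FiniteMoments

variable (hind : iIndepFun η P) (hlaw : ∀ i, HasLaw (η i) (gaussianReal (a i) 1) P)
include hind hlaw

lemma mgf_partialQuad_le {F : Finset ι} (hq : ∀ i ∈ F, 0 ≤ q i) {t : ℝ}
    (ht : ∀ i ∈ F, q i * |t| ≤ 1 / 8) :
    mgf (partialQuad q η F) P t ≤
      exp (4 * t ^ 2 * ∑ i ∈ F, q i ^ 2 + (t + |t| / 2) * ∑ i ∈ F, q i * a i ^ 2) := by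
  rw [mgf_partialQuad hind fun i => (hlaw i).aemeasurable, Finset.mul_sum, Finset.mul_sum,
    ← Finset.sum_add_distrib, exp_sum]
  refine Finset.prod_le_prod (fun i _ => mgf_nonneg) fun i hi => ?_
  have habs : |q i * t| = q i * |t| := by rw [abs_mul, abs_of_nonneg (hq i hi)]
  refine (mgf_sq_sub_one_le (hlaw i) (habs ▸ ht i hi)).trans_eq ?_
  rw [habs]
  ring_nf

lemma exp_le_mgf_partialQuad {F : Finset ι} (hq : ∀ i ∈ F, 0 ≤ q i) {t : ℝ} (ht₀ : 0 ≤ t)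
    (ht : ∀ i ∈ F, 2 * (q i * t) < 1) :
    exp (t ^ 2 * ∑ i ∈ F, q i ^ 2) ≤ mgf (partialQuad q η F) P t := by
  rw [mgf_partialQuad hind fun i => (hlaw i).aemeasurable, Finset.mul_sum, exp_sum]
  refine Finset.prod_le_prod (fun i _ => (exp_pos _).le) fun i hi => ?_
  rw [← mul_pow, mul_comm t]
  exact exp_sq_le_mgf_sq_sub_one (hlaw i) (mul_nonneg (hq i hi) ht₀) (ht i hi)

lemma integrable_exp_mul_partialQuad {F : Finset ι} {t : ℝ} (ht : ∀ i ∈ F, 2 * (q i * t) < 1) :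
    Integrable (fun ω => exp (t * partialQuad q η F ω)) P := by
  refine Integrable.of_integral_ne_zero ?_
  change mgf _ P t ≠ 0
  rw [mgf_partialQuad hind fun i => (hlaw i).aemeasurable]
  refine Finset.prod_ne_zero_iff.2 fun i hi => ?_
  rw [mgf_sq_sub_one (hlaw i) (ht i hi)]
  exact exp_ne_zero _

lemma le_measureReal_lt_partialQuad [IsProbabilityMeasure P] {F : Finset ι}
    (hq : ∀ i ∈ F, 0 ≤ q i) {t : ℝ} (ht₀ : 0 < t) (ht : ∀ i ∈ F, q i * (2 * t) ≤ 1 / 8) :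
    exp (-(16 * t ^ 2 * ∑ i ∈ F, q i ^ 2 + 3 * t * ∑ i ∈ F, q i * a i ^ 2)) / 4 ≤
      P.real {ω | t * ∑ i ∈ F, q i ^ 2 - log 2 / t < partialQuad q η F ω} := by
  set V := ∑ i ∈ F, q i ^ 2 with hV
  set D := ∑ i ∈ F, q i * a i ^ 2 with hD
  have hmgf : exp (t ^ 2 * V) ≤ mgf (partialQuad q η F) P t :=
    exp_le_mgf_partialQuad hind hlaw hq ht₀.le fun i hi => by linarith [ht i hi]
  have hmgf_two : mgf (partialQuad q η F) P (2 * t) ≤ exp (16 * t ^ 2 * V + 3 * t * D) := by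
    have habs : |2 * t| = 2 * t := abs_of_pos (by linarith)
    refine (mgf_partialQuad_le hind hlaw hq (by rwa [habs])).trans_eq ?_
    rw [habs, ← hV, ← hD]
    ring_nf
  have hsub : {ω | mgf (partialQuad q η F) P t / 2 < exp (t * partialQuad q η F ω)} ⊆
      {ω | t * V - log 2 / t < partialQuad q η F ω} := fun ω hω => by
    have hlt : exp (t ^ 2 * V - log 2) < exp (t * partialQuad q η F ω) :=
      calc exp (t ^ 2 * V - log 2) = exp (t ^ 2 * V) / 2 := by rw [exp_sub, exp_log two_pos]
        _ ≤ mgf (partialQuad q η F) P t / 2 := by gcongr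
        _ < _ := hω
    rw [Set.mem_ofPred_eq, ← mul_lt_mul_iff_right₀ ht₀, mul_sub, mul_div_cancel₀ _ ht₀.ne',
      ← mul_assoc, ← sq]
    exact exp_lt_exp.1 hlt
  have hone : 1 ≤ mgf (partialQuad q η F) P t := (one_le_exp (by positivity)).trans hmgf
  rw [exp_neg, div_eq_mul_inv, inv_mul_le_iff₀ (exp_pos _)]
  calc (4 : ℝ)⁻¹ ≤ (1 / 4) * mgf (partialQuad q η F) P t ^ 2 := by nlinarith
    _ ≤ mgf (partialQuad q η F) P (2 * t) *
        P.real {ω | mgf (partialQuad q η F) P t / 2 < exp (t * partialQuad q η F ω)} :=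
      sq_mgf_le_mul_measureReal
        (integrable_exp_mul_partialQuad hind hlaw fun i hi => by linarith [ht i hi])
    _ ≤ _ := mul_le_mul hmgf_two (measureReal_mono hsub) measureReal_nonneg (exp_pos _).le

end FiniteMoments

lemma measureReal_mem_le_of_ae_tendsto [IsProbabilityMeasure P] {l : Filter ι} [l.NeBot]
    [l.IsCountablyGenerated] {X : ι → Ω → ℝ} {Z : Ω → ℝ} (hX : ∀ i, AEMeasurable (X i) P)
    (hlim : ∀ᵐ ω ∂P, Tendsto (fun i => X i ω) l (𝓝 (Z ω))) {U : Set ℝ} (hU : IsOpen U)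
    {p : ι → ℝ} {p₀ : ℝ} (hp : Tendsto p l (𝓝 p₀))
    (hle : ∀ᶠ i in l, P.real {ω | X i ω ∈ U} ≤ p i) :
    P.real {ω | Z ω ∈ U} ≤ p₀ := by
  have hZ : AEMeasurable Z P := aemeasurable_of_tendsto_metrizable_ae l hX hlim
  have hmap : ∀ {Y : Ω → ℝ}, AEMeasurable Y P →
      P.map Y U = ENNReal.ofReal (P.real {ω | Y ω ∈ U}) :=
    fun hY => by
      rw [Measure.map_apply_of_aemeasurable hY hU.measurableSet, ofReal_measureReal]
      rfl
  have hopen := ProbabilityMeasure.le_liminf_measure_open_of_tendsto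
    (tendstoInDistribution_of_ae_tendsto hX hZ hlim).tendsto hU
  simp only [ProbabilityMeasure.coe_mk, hmap hZ, hmap (hX _)] at hopen
  have hlimit : ENNReal.ofReal (P.real {ω | Z ω ∈ U}) ≤ ENNReal.ofReal p₀ :=
    calc _ ≤ _ := hopen
      _ ≤ liminf (fun i => ENNReal.ofReal (p i)) l :=
        liminf_le_liminf (hle.mono fun i hi => ENNReal.ofReal_le_ofReal hi)
      _ = ENNReal.ofReal p₀ := (ENNReal.tendsto_ofReal hp).liminf_eq
  have hp₀ : 0 ≤ p₀ := ge_of_tendsto hp (hle.mono fun i hi => measureReal_nonneg.trans hi)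
  exact (ENNReal.ofReal_le_ofReal_iff hp₀).1 hlimit

lemma integral_sq_gaussianReal (μ : ℝ) (v : ℝ≥0) :
    ∫ x, x ^ 2 ∂gaussianReal μ v = v + μ ^ 2 := by
  have hvar := variance_eq_sub (memLp_id_gaussianReal (μ := μ) (v := v) 2)
  simp only [variance_id_gaussianReal, Pi.pow_apply, id_eq, integral_id_gaussianReal] at hvar
  linarith

/-- The sum `∑ q_i η_i²` is a weighted noncentral chi-square sum: the `η_i` are independent
Gaussian variables with means `a_i` and unit variances, and the series of weights `q_i ≥ 0` and the
noncentrality `∑ q_i a_i²` converge. -/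
structure IsWeightedChiSq (P : Measure Ω) (q a : ι → ℝ) (η : ι → Ω → ℝ) : Prop where
  iIndepFun : iIndepFun η P
  hasLaw : ∀ i, HasLaw (η i) (gaussianReal (a i) 1) P
  weight_nonneg : ∀ i, 0 ≤ q i
  summable_weight : Summable q
  summable_noncentrality : Summable fun i => q i * a i ^ 2

namespace IsWeightedChiSq

variable (h : IsWeightedChiSq P q a η)
include h

lemma aemeasurable (i : ι) : AEMeasurable (η i) P := (h.hasLaw i).aemeasurable

lemma summable_weight_sq : Summable fun i => q i ^ 2 := by
  refine summable_of_isBigO h.summable_weight ?_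
  simpa only [sq, mul_one] using (isBigO_refl q cofinite).mul
    (h.summable_weight.tendsto_cofinite_zero.isBigO_one ℝ)

lemma ae_summable [Countable ι] : ∀ᵐ ω ∂P, Summable fun i => q i * η i ω ^ 2 := by
  have hmean : ∀ i, ∫ ω, η i ω ^ 2 ∂P = 1 + a i ^ 2 := fun i => by
    rw [← NNReal.coe_one, ← integral_sq_gaussianReal (a i) 1,
      ← (h.hasLaw i).integral_comp (by fun_prop)]
    rfl
  have hint : ∀ i, Integrable (fun ω => q i * η i ω ^ 2) P := fun i =>
    (Integrable.of_integral_ne_zero (by rw [hmean]; positivity)).const_mul _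
  have hnorm : ∀ i, eLpNorm (fun ω => q i * η i ω ^ 2) 1 P =
      ENNReal.ofReal (q i + q i * a i ^ 2) := fun i => by
    have hnonneg : ∀ ω, ‖q i * η i ω ^ 2‖ = q i * η i ω ^ 2 := fun ω =>
      norm_of_nonneg (mul_nonneg (h.weight_nonneg i) (sq_nonneg _))
    rw [eLpNorm_one_eq_lintegral_enorm, ← ofReal_integral_norm_eq_lintegral_enorm (hint i)]
    simp only [hnonneg]
    rw [integral_const_mul, hmean, mul_add, mul_one]
  have hfinite : ∑' i, eLpNorm (fun ω => q i * η i ω ^ 2) 1 P ≠ ∞ := by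
    simpa only [hnorm] using
      (h.summable_weight.add h.summable_noncentrality).tsum_ofReal_ne_top
  filter_upwards [summable_norm_of_tsum_eLpNorm_ne_top le_rfl
    (fun i => (hint i).aestronglyMeasurable) hfinite] with ω hω using hω.of_norm

variable [IsProbabilityMeasure P] [Countable ι]

lemma measureReal_quadForm_mem_le {U : Set ℝ} (hU : IsOpen U) {p : Finset ι → ℝ} {p₀ : ℝ}
    (hp : Tendsto p atTop (𝓝 p₀))
    (hle : ∀ᶠ F in atTop, P.real {ω | partialQuad q η F ω ∈ U} ≤ p F) :
    P.real {ω | quadForm q η ω ∈ U} ≤ p₀ := by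
  refine measureReal_mem_le_of_ae_tendsto (aemeasurable_partialQuad h.aemeasurable) ?_ hU hp hle
  filter_upwards [h.ae_summable] with ω hω using tendsto_partialQuad h.summable_weight hω

lemma measureReal_lt_quadForm_le {t : ℝ} (ht₀ : 0 ≤ t) (ht : ∀ i, q i * t ≤ 1 / 8) (x : ℝ) :
    P.real {ω | x < quadForm q η ω} ≤
      exp (-t * x + (4 * t ^ 2 * ∑' i, q i ^ 2 + (t + t / 2) * ∑' i, q i * a i ^ 2)) := by
  have hV : Tendsto (fun F => ∑ i ∈ F, q i ^ 2) atTop _ := h.summable_weight_sq.hasSum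
  have hD : Tendsto (fun F => ∑ i ∈ F, q i * a i ^ 2) atTop _ := h.summable_noncentrality.hasSum
  have hlim := (((hV.const_mul (4 * t ^ 2)).add (hD.const_mul (t + t / 2))).const_add
    (-t * x)).rexp
  refine h.measureReal_quadForm_mem_le isOpen_Ioi hlim (Eventually.of_forall fun F => ?_)
  calc P.real {ω | partialQuad q η F ω ∈ Set.Ioi x}
    _ ≤ P.real {ω | x ≤ partialQuad q η F ω} :=
      measureReal_mono fun ω (hω : x < partialQuad q η F ω) => hω.le
    _ ≤ exp (-t * x) * mgf (partialQuad q η F) P t :=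
      measure_ge_le_exp_mul_mgf x ht₀ (integrable_exp_mul_partialQuad h.iIndepFun h.hasLaw
        fun i _ => by linarith [ht i])
    _ ≤ _ := by
      rw [exp_add]
      gcongr
      simpa only [abs_of_nonneg ht₀] using mgf_partialQuad_le h.iIndepFun h.hasLaw
        (fun i _ => h.weight_nonneg i) (F := F) (t := t)
        fun i _ => by rw [abs_of_nonneg ht₀]; exact ht i

lemma measureReal_quadForm_lt_le {t : ℝ} (ht₀ : 0 ≤ t) (ht : ∀ i, q i * t ≤ 1 / 8) (x : ℝ) :
    P.real {ω | quadForm q η ω < x} ≤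
      exp (t * x + (4 * t ^ 2 * ∑' i, q i ^ 2 - t / 2 * ∑' i, q i * a i ^ 2)) := by
  have hV : Tendsto (fun F => ∑ i ∈ F, q i ^ 2) atTop _ := h.summable_weight_sq.hasSum
  have hD : Tendsto (fun F => ∑ i ∈ F, q i * a i ^ 2) atTop _ := h.summable_noncentrality.hasSum
  have hlim := (((hV.const_mul (4 * t ^ 2)).sub (hD.const_mul (t / 2))).const_add (t * x)).rexp
  refine h.measureReal_quadForm_mem_le isOpen_Iio hlim (Eventually.of_forall fun F => ?_)
  have habs : |-t| = t := by rw [abs_neg, abs_of_nonneg ht₀]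
  calc P.real {ω | partialQuad q η F ω ∈ Set.Iio x}
    _ ≤ P.real {ω | partialQuad q η F ω ≤ x} :=
      measureReal_mono fun ω (hω : partialQuad q η F ω < x) => hω.le
    _ ≤ exp (- -t * x) * mgf (partialQuad q η F) P (-t) :=
      measure_le_le_exp_mul_mgf x (neg_nonpos.2 ht₀)
        (integrable_exp_mul_partialQuad h.iIndepFun h.hasLaw fun i _ => by
          linarith [mul_nonneg (h.weight_nonneg i) ht₀])
    _ ≤ exp (- -t * x) * exp (4 * (-t) ^ 2 * ∑ i ∈ F, q i ^ 2 +
        (-t + |-t| / 2) * ∑ i ∈ F, q i * a i ^ 2) := by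
      gcongr
      exact mgf_partialQuad_le h.iIndepFun h.hasLaw (fun i _ => h.weight_nonneg i)
        fun i _ => by rw [habs]; exact ht i
    _ = _ := by
      rw [← exp_add, habs]
      ring_nf

lemma le_measureReal_le_quadForm {t : ℝ} (ht₀ : 0 < t) (ht : ∀ i, q i * (2 * t) ≤ 1 / 8)
    {x : ℝ} (hx : x < t * ∑' i, q i ^ 2 - log 2 / t) :
    exp (-(16 * t ^ 2 * ∑' i, q i ^ 2 + 3 * t * ∑' i, q i * a i ^ 2)) / 4 ≤
      P.real {ω | x ≤ quadForm q η ω} := by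
  have hV : Tendsto (fun F => ∑ i ∈ F, q i ^ 2) atTop _ := h.summable_weight_sq.hasSum
  have hD : Tendsto (fun F => ∑ i ∈ F, q i * a i ^ 2) atTop _ := h.summable_noncentrality.hasSum
  have hlim := (((hV.const_mul (16 * t ^ 2)).add (hD.const_mul (3 * t))).neg.rexp.div_const
    4).const_sub 1
  have hlt : P.real {ω | quadForm q η ω < x} ≤ 1 - exp (-(16 * t ^ 2 * ∑' i, q i ^ 2 +
      3 * t * ∑' i, q i * a i ^ 2)) / 4 := by
    refine h.measureReal_quadForm_mem_le isOpen_Iio hlim ?_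
    filter_upwards [((hV.const_mul t).sub_const (log 2 / t)).eventually_const_lt hx] with F hF
    have hcompl := probReal_compl_eq_one_sub₀ (nullMeasurableSet_lt
      (aemeasurable_partialQuad (q := q) h.aemeasurable F) (aemeasurable_const (b := x)))
    refine le_sub_comm.1 (le_trans ?_ hcompl.le)
    refine (le_measureReal_lt_partialQuad h.iIndepFun h.hasLaw
      (fun i _ => h.weight_nonneg i) ht₀ fun i _ => ht i).trans (measureReal_mono ?_)
    exact fun ω hω => not_lt.2 (hF.trans hω).le
  have hadd := measureReal_union_le (μ := P) {ω | quadForm q η ω < x} {ω | x ≤ quadForm q η ω}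
  rw [show {ω | quadForm q η ω < x} ∪ {ω | x ≤ quadForm q η ω} = Set.univ from
    Set.eq_univ_of_forall fun ω => lt_or_ge (quadForm q η ω) x, probReal_univ] at hadd
  linarith

end IsWeightedChiSq

end QuadraticForms

/-! ### Error probabilities of the tests -/

section WhiteNoise

variable {Ω : Type*} [MeasurableSpace Ω] {P : Measure Ω} {W : L2 → Ω → ℝ}

namespace IsWhiteNoise

variable (hW : IsWhiteNoise P W)
include hW

lemma hasLaw {f : L2} (hf : ‖f‖ = 1) : HasLaw (W f) (gaussianReal 0 1) P := by
  have hgauss := hW.isGaussianProcess.hasGaussianLaw_eval f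
  have hvar : Var[W f; P] = 1 := by
    rw [← covariance_self hgauss.aemeasurable, hW.covariance_eq, real_inner_self_eq_norm_sq, hf,
      one_pow]
  refine ⟨hgauss.aemeasurable, ?_⟩
  rw [hgauss.map_eq_gaussianReal, hvar, hW.mean_eq_zero, toNNReal_one]

lemma iIndepFun {ι : Type*} {v : ι → L2} (hv : Orthonormal ℝ v) :
    iIndepFun (fun i => W (v i)) P := by
  have hind := IsGaussianProcess.iIndepFun_of_covariance_eq_zero
    (X := fun (i : ι) (_ : Unit) => W (v i))
    (hW.isGaussianProcess.comp_right fun p : (_ : ι) × Unit => v p.1)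
    (fun i _ => (hW.isGaussianProcess.hasGaussianLaw_eval (v i)).aemeasurable)
    (fun i j hij _ _ => by rw [hW.covariance_eq]; exact hv.2 hij)
  exact hind.comp (fun _ (x : Unit → ℝ) => x ()) fun _ => measurable_pi_apply _

end IsWhiteNoise

variable {φ : HilbertBasis ℕ+ ℝ L2} {ϰ : ℝ → ℕ → ℝ} {ε : ℝ} {S : L2}

lemma hasSum_fourier_sq (φ : HilbertBasis ℕ+ ℝ L2) (S : L2) :
    HasSum (fun j => fourier φ S j ^ 2) (‖S‖ ^ 2) := by
  rw [← real_inner_self_eq_norm_sq]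
  refine (φ.hasSum_inner_mul_inner S S).congr_fun fun j => ?_
  rw [fourier, sq, real_inner_comm S]

lemma summable_mul_fourier_sq {b : ℕ+ → ℝ} (hb : Summable b) :
    Summable fun j => b j * fourier φ S j ^ 2 := by
  refine summable_of_isBigO (hasSum_fourier_sq φ S).summable ?_
  simpa only [one_mul] using (hb.tendsto_cofinite_zero.isBigO_one ℝ).mul
    (isBigO_refl (fun j => fourier φ S j ^ 2) cofinite)

/-- `A_ε(S) = ε⁻⁴ ∑_j ϰ_{εj}² θ_j²`, the mean of `ε⁻² T_ε` under the signal `S`. -/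
noncomputable def drift (φ : HilbertBasis ℕ+ ℝ L2) (ϰ : ℝ → ℕ → ℝ) (ε : ℝ) (S : L2) : ℝ :=
  (ε ^ 4)⁻¹ * ∑' j : ℕ+, ϰ ε j ^ 2 * fourier φ S j ^ 2

/-- The critical value `A_ε^{1/2} ε⁻² x` for `ε⁻² T_ε`: the test with critical value `x` for
`A_ε^{-1/2} T_ε` rejects exactly when `ε⁻² T_ε` exceeds it. -/
noncomputable def threshold (ϰ : ℝ → ℕ → ℝ) (ε x : ℝ) : ℝ := √(bigA ϰ ε) * x / ε ^ 2

lemma drift_nonneg : 0 ≤ drift φ ϰ ε S :=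
  mul_nonneg (by positivity) (tsum_nonneg fun _ => by positivity)

lemma drift_zero : drift φ ϰ ε 0 = 0 := by
  simp [drift, fourier]

lemma tsum_sq_weight : ∑' j : ℕ+, (ϰ ε j ^ 2 / ε ^ 2) ^ 2 = bigA ϰ ε := by
  rw [bigA, ← tsum_mul_left]
  exact tsum_congr fun j => by ring

lemma tsum_noncentrality :
    ∑' j : ℕ+, ϰ ε j ^ 2 / ε ^ 2 * (fourier φ S j / ε) ^ 2 = drift φ ϰ ε S := by
  rw [drift, ← tsum_mul_left]
  exact tsum_congr fun j => by ring

omit [MeasurableSpace Ω] in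
lemma quadForm_obs (ω : Ω) :
    quadForm (fun j : ℕ+ => ϰ ε j ^ 2 / ε ^ 2) (fun j ω => obs W φ ε S j ω / ε) ω =
      stat W φ ϰ ε S ω / ε ^ 2 := by
  have hobs : ∀ j : ℕ+, ϰ ε j ^ 2 / ε ^ 2 * (obs W φ ε S j ω / ε) ^ 2 =
      (ε ^ 2)⁻¹ * (ϰ ε j ^ 2 * obs W φ ε S j ω ^ 2) / ε ^ 2 := fun j => by ring
  simp only [quadForm, hobs, tsum_div_const, tsum_mul_left, stat, rhoSq, sub_div]

omit [MeasurableSpace Ω] in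
lemma rejects_eq (hε : 0 < ε) (hA : 0 < bigA ϰ ε) (x : ℝ) :
    rejects W φ ϰ ε S x = {ω | threshold ϰ ε x <
      quadForm (fun j : ℕ+ => ϰ ε j ^ 2 / ε ^ 2) (fun j ω => obs W φ ε S j ω / ε) ω} := by
  ext ω
  simp only [rejects, Set.mem_ofPred_eq, quadForm_obs, threshold]
  rw [div_lt_div_iff_of_pos_right (by positivity), rpow_neg hA.le, ← sqrt_eq_rpow,
    lt_inv_mul_iff₀ (sqrt_pos.2 hA)]

section ErrorProbabilities

variable (hW : IsWhiteNoise P W) (hε : 0 < ε) (hsum : Summable fun j : ℕ+ => ϰ ε j ^ 2)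
include hW hε hsum

lemma isWeightedChiSq (φ : HilbertBasis ℕ+ ℝ L2) (S : L2) :
    IsWeightedChiSq P (fun j : ℕ+ => ϰ ε j ^ 2 / ε ^ 2) (fun j => fourier φ S j / ε)
      (fun j ω => obs W φ ε S j ω / ε) := by
  have hobs : ∀ j ω, obs W φ ε S j ω / ε = fourier φ S j / ε + W (φ j) ω := fun j ω => by
    rw [obs, add_div, mul_div_cancel_left₀ _ hε.ne']
  refine ⟨?_, fun j => ?_, fun j => by positivity, hsum.div_const _, ?_⟩
  · simp only [hobs]
    exact (hW.iIndepFun φ.orthonormal).comp (fun j x => fourier φ S j / ε + x) fun j => by fun_prop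
  · simpa only [hobs, zero_add] using
      gaussianReal_const_add (hW.hasLaw (φ.orthonormal.1 j)) (fourier φ S j / ε)
  · refine ((summable_mul_fourier_sq (φ := φ) (S := S) hsum).div_const (ε ^ 4)).congr fun j => ?_
    ring

variable (hA : 0 < bigA ϰ ε) [IsProbabilityMeasure P]
include hA

lemma typeI_le {t : ℝ} (ht₀ : 0 ≤ t) (ht : ∀ j : ℕ+, ϰ ε j ^ 2 / ε ^ 2 * t ≤ 1 / 8) (x : ℝ) :
    typeI P W φ ϰ ε x ≤ exp (-t * threshold ϰ ε x + 4 * t ^ 2 * bigA ϰ ε) := by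
  have htail := (isWeightedChiSq hW hε hsum φ 0).measureReal_lt_quadForm_le ht₀ ht
    (threshold ϰ ε x)
  rwa [tsum_sq_weight, tsum_noncentrality, drift_zero, mul_zero, add_zero, ← rejects_eq hε hA]
    at htail

lemma typeII_le {t : ℝ} (ht₀ : 0 ≤ t) (ht : ∀ j : ℕ+, ϰ ε j ^ 2 / ε ^ 2 * t ≤ 1 / 8) {x y : ℝ}
    (hxy : threshold ϰ ε x < y) :
    typeII P W φ ϰ ε S x ≤
      exp (t * y + (4 * t ^ 2 * bigA ϰ ε - t / 2 * drift φ ϰ ε S)) := by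
  have htail := (isWeightedChiSq hW hε hsum φ S).measureReal_quadForm_lt_le ht₀ ht y
  rw [tsum_sq_weight, tsum_noncentrality] at htail
  rw [typeII, rejects_eq hε hA]
  exact (measureReal_mono fun ω hω => (not_lt.1 hω).trans_lt hxy).trans htail

lemma le_typeI {t : ℝ} (ht₀ : 0 < t) (ht : ∀ j : ℕ+, ϰ ε j ^ 2 / ε ^ 2 * (2 * t) ≤ 1 / 8) {x : ℝ}
    (hx : threshold ϰ ε x < t * bigA ϰ ε - log 2 / t) :
    exp (-(16 * t ^ 2 * bigA ϰ ε)) / 4 ≤ typeI P W φ ϰ ε x := by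
  obtain ⟨y, hxy, hy⟩ := exists_between hx
  have htail := (isWeightedChiSq hW hε hsum φ 0).le_measureReal_le_quadForm ht₀ ht
    (x := y) (by rwa [tsum_sq_weight])
  rw [tsum_sq_weight, tsum_noncentrality, drift_zero, mul_zero, add_zero] at htail
  rw [typeI, rejects_eq hε hA]
  exact htail.trans (measureReal_mono fun ω hω => hxy.trans_le hω)

lemma le_typeII {t : ℝ} (ht₀ : 0 ≤ t) (ht : ∀ j : ℕ+, ϰ ε j ^ 2 / ε ^ 2 * t ≤ 1 / 8) (x : ℝ) :
    1 - exp (-t * threshold ϰ ε x + (4 * t ^ 2 * bigA ϰ ε + (t + t / 2) * drift φ ϰ ε S)) ≤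
      typeII P W φ ϰ ε S x := by
  have htail := (isWeightedChiSq hW hε hsum φ S).measureReal_lt_quadForm_le ht₀ ht
    (threshold ϰ ε x)
  rw [tsum_sq_weight, tsum_noncentrality, ← rejects_eq hε hA] at htail
  have hadd := measureReal_union_le (μ := P) (rejects W φ ϰ ε S x) (rejects W φ ϰ ε S x)ᶜ
  rw [Set.union_compl_self, probReal_univ] at hadd
  rw [typeII]
  linarith

end ErrorProbabilities

end WhiteNoise

/-! ### Consistency in the Cramér zone -/

section CramerZone

variable {ι Ω : Type*} [MeasurableSpace Ω] {P : Measure Ω} {W : L2 → Ω → ℝ}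
  {φ : HilbertBasis ℕ+ ℝ L2} {ϰ : ℝ → ℕ → ℝ} {l : Filter ι} {e R x : ι → ℝ} {S : ι → L2}

/-- The rates `R` lie in the Cramér zone of the statistics along the noise levels `e`: they tend to
infinity, but slowly enough for the largest weight `ϰ_{ε1}² / ε²` to be `o(R⁻¹)`, so that the
deviations of `ε⁻² T_ε` of order `R` are of Gaussian type. -/
structure IsCramerRate (ϰ : ℝ → ℕ → ℝ) (l : Filter ι) (e R : ι → ℝ) : Prop where
  eventually_pos : ∀ᶠ i in l, 0 < e i
  tendsto_atTop : Tendsto R l atTop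
  tendsto_weight : Tendsto (fun i => ϰ (e i) 1 ^ 2 / e i ^ 2 * R i) l (𝓝 0)

namespace IsCramerRate

variable (hR : IsCramerRate ϰ l e R)
include hR

lemma comp {κ : Type*} {k : Filter κ} {u : κ → ι} (hu : Tendsto u k l) :
    IsCramerRate ϰ k (e ∘ u) (R ∘ u) :=
  ⟨hu.eventually hR.eventually_pos, hR.tendsto_atTop.comp hu, hR.tendsto_weight.comp hu⟩

variable (hA1 : A1 ϰ)
include hA1

lemma eventually_weight_mul_le {u : ι → ℝ} (hu : u =O[l] R) :
    ∀ᶠ i in l, ∀ j : ℕ+, ϰ (e i) j ^ 2 / e i ^ 2 * u i ≤ 1 / 8 := by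
  have hlim : Tendsto (fun i => ϰ (e i) 1 ^ 2 / e i ^ 2 * u i) l (𝓝 0) :=
    ((isBigO_refl _ l).mul hu).trans_tendsto hR.tendsto_weight
  filter_upwards [hR.eventually_pos, hlim.abs.eventually_le_const
    (by norm_num : |(0 : ℝ)| < 1 / 8)] with i hpos hi j
  have hj : ϰ (e i) j ^ 2 ≤ ϰ (e i) 1 ^ 2 := hA1 _ hpos Set.self_mem_Ici j.pos j.pos
  calc ϰ (e i) j ^ 2 / e i ^ 2 * u i ≤ ϰ (e i) j ^ 2 / e i ^ 2 * |u i| := by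
        gcongr
        exact le_abs_self _
    _ ≤ ϰ (e i) 1 ^ 2 / e i ^ 2 * |u i| := by gcongr
    _ = |ϰ (e i) 1 ^ 2 / e i ^ 2 * u i| := by
        rw [abs_mul, abs_of_nonneg (by positivity : 0 ≤ ϰ (e i) 1 ^ 2 / e i ^ 2)]
    _ ≤ 1 / 8 := hi

lemma eventually_weight_mul_const_mul_le (τ : ℝ) :
    ∀ᶠ i in l, ∀ j : ℕ+, ϰ (e i) j ^ 2 / e i ^ 2 * (τ * R i) ≤ 1 / 8 :=
  hR.eventually_weight_mul_le hA1 (isBigO_const_mul_self τ R l)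

variable [IsProbabilityMeasure P] (hW : IsWhiteNoise P W)
  (hsum : ∀ ε > 0, Summable fun j : ℕ+ => ϰ ε j ^ 2) (hA2 : A2 ϰ)
include hW hsum hA2

lemma eventually_threshold_lt (hα₀ : ∀ᶠ i in l, 0 < typeI P W φ ϰ (e i) (x i))
    (hα : Tendsto (fun i => (R i ^ 2)⁻¹ * log (typeI P W φ ϰ (e i) (x i))) l (𝓝 0))
    {η : ℝ} (hη : 0 < η) : ∀ᶠ i in l, threshold ϰ (e i) (x i) < η * R i := by
  obtain ⟨m₁, hm₁, m₂, hm₂, hA⟩ := hA2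
  set τ := η / (8 * m₂) with hτ
  have hτ₀ : 0 < τ := by positivity
  have hrate : -(η * τ / 2) < 0 := by linarith [mul_pos hη hτ₀]
  filter_upwards [hR.eventually_pos, hR.tendsto_atTop.eventually_gt_atTop 0,
    hR.eventually_weight_mul_const_mul_le hA1 τ, hα₀, hα.eventually_const_lt hrate]
    with i hpos hRi hweight hα₀i hαi
  obtain ⟨hA₁, hA₂⟩ := hA _ hpos
  by_contra! hge
  have hlog : log (typeI P W φ ϰ (e i) (x i)) ≤ -(η * τ / 2) * R i ^ 2 := by
    rw [log_le_iff_le_exp hα₀i]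
    refine (typeI_le hW hpos (hsum _ hpos) (hm₁.trans hA₁) (mul_pos hτ₀ hRi).le hweight _).trans
      (exp_le_exp.2 ?_)
    calc -(τ * R i) * threshold ϰ (e i) (x i) + 4 * (τ * R i) ^ 2 * bigA ϰ (e i)
      _ ≤ -(τ * R i) * (η * R i) + 4 * (τ * R i) ^ 2 * m₂ := by
        rw [neg_mul, neg_mul]
        gcongr
      _ = -(η * τ / 2) * R i ^ 2 := by
        rw [hτ]
        field_simp
        ring
  rw [inv_mul_eq_div, lt_div_iff₀ (by positivity)] at hαi
  exact absurd hlog hαi.not_ge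

theorem ldConsistent (hdrift : R =O[l] fun i => drift φ ϰ (e i) (S i)) :
    LDConsistent P W φ ϰ l e R S := by
  intro x hα₀ hα
  obtain ⟨m₁, hm₁, m₂, hm₂, hA⟩ := id hA2
  obtain ⟨C, hC, hbound⟩ := hdrift.exists_pos
  set c := C⁻¹
  have hc₀ : 0 < c := by positivity
  set τ := c / (32 * m₂) with hτ
  have hτ₀ : 0 < τ := by positivity
  refine ⟨c * τ / 4, by positivity, ?_⟩
  filter_upwards [hR.eventually_pos, hR.tendsto_atTop.eventually_gt_atTop 0,
    hR.eventually_weight_mul_const_mul_le hA1 τ, hbound.bound,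
    hR.eventually_threshold_lt hA1 hW hsum hA2 hα₀ hα (by positivity : 0 < c / 8)]
    with i hpos hRi hweight hdrifti hthr
  obtain ⟨hA₁, hA₂⟩ := hA _ hpos
  have hcR : c * R i ≤ drift φ ϰ (e i) (S i) := by
    rwa [norm_of_nonneg hRi.le, norm_of_nonneg drift_nonneg, ← inv_mul_le_iff₀ hC] at hdrifti
  refine (typeII_le hW hpos (hsum _ hpos) (hm₁.trans hA₁) (mul_pos hτ₀ hRi).le hweight
    hthr).trans (exp_le_exp.2 ?_)
  calc τ * R i * (c / 8 * R i) +
        (4 * (τ * R i) ^ 2 * bigA ϰ (e i) - τ * R i / 2 * drift φ ϰ (e i) (S i))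
    _ ≤ τ * R i * (c / 8 * R i) + (4 * (τ * R i) ^ 2 * m₂ - τ * R i / 2 * (c * R i)) := by gcongr
    _ = -(c * τ / 4 * R i ^ 2) := by
      rw [hτ]
      field_simp
      ring

lemma exists_le_typeI {u : ι → ℝ} (hu₁ : ∀ᶠ i in l, 1 ≤ u i) (hu : u =O[l] R)
    (hx : ∀ᶠ i in l, threshold ϰ (e i) (x i) ≤ u i) :
    ∃ C : ℝ, ∀ᶠ i in l, exp (-(C * u i ^ 2)) / 4 ≤ typeI P W φ ϰ (e i) (x i) := by
  obtain ⟨m₁, hm₁, m₂, -, hA⟩ := hA2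
  set L := 2 / m₁ + 1 with hL
  have hL₁ : 1 ≤ L := by linarith [div_pos two_pos hm₁]
  have hLm : 2 ≤ L * m₁ := by
    rw [hL, add_mul, div_mul_cancel₀ _ hm₁.ne']
    linarith
  refine ⟨16 * L ^ 2 * m₂, ?_⟩
  filter_upwards [hR.eventually_pos, hu₁, hx,
    hR.eventually_weight_mul_le hA1 (hu.const_mul_left (2 * L))] with i hpos hui hxi hweight
  obtain ⟨hA₁, hA₂⟩ := hA _ hpos
  have hthr : threshold ϰ (e i) (x i) < L * u i * bigA ϰ (e i) - log 2 / (L * u i) := by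
    have hlog : log 2 / (L * u i) < 1 := by
      rw [div_lt_one (by positivity)]
      nlinarith [log_two_lt_d9]
    have hmean : 2 * u i ≤ L * u i * bigA ϰ (e i) :=
      calc 2 * u i ≤ L * m₁ * u i := by gcongr
        _ = L * u i * m₁ := by ring
        _ ≤ L * u i * bigA ϰ (e i) := by gcongr
    linarith
  refine le_trans ?_ (le_typeI hW hpos (hsum _ hpos) (hm₁.trans hA₁) (by positivity)
    (fun j => by rw [← mul_assoc 2 L]; exact hweight j) hthr)
  have hexp : 16 * (L * u i) ^ 2 * bigA ϰ (e i) ≤ 16 * L ^ 2 * m₂ * u i ^ 2 :=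
    calc 16 * (L * u i) ^ 2 * bigA ϰ (e i) ≤ 16 * (L * u i) ^ 2 * m₂ := by gcongr
      _ = 16 * L ^ 2 * m₂ * u i ^ 2 := by ring
  gcongr

lemma tendsto_log_typeI {u : ι → ℝ} (hu₁ : ∀ᶠ i in l, 1 ≤ u i) (hu : u =o[l] R)
    (hx : ∀ᶠ i in l, threshold ϰ (e i) (x i) ≤ u i) :
    (∀ᶠ i in l, 0 < typeI P W φ ϰ (e i) (x i)) ∧
      Tendsto (fun i => (R i ^ 2)⁻¹ * log (typeI P W φ ϰ (e i) (x i))) l (𝓝 0) := by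
  obtain ⟨C, hC⟩ := hR.exists_le_typeI (φ := φ) hA1 hW hsum hA2 hu₁ hu.isBigO hx
  have hR₂ : Tendsto (fun i => R i ^ 2) l atTop :=
    (tendsto_pow_atTop two_ne_zero).comp hR.tendsto_atTop
  have hlower : Tendsto (fun i => (-(C * u i ^ 2) - log 4) / R i ^ 2) l (𝓝 0) := by
    refine (IsLittleO.sub ?_ ?_).tendsto_div_nhds_zero
    · exact ((hu.pow two_pos).const_mul_left C).neg_left
    · exact isLittleO_const_left.2 (Or.inr (tendsto_norm_atTop_atTop.comp hR₂))
  refine ⟨hC.mono fun i hi => (by positivity : (0 : ℝ) < _).trans_le hi,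
    tendsto_of_tendsto_of_tendsto_of_le_of_le' hlower tendsto_const_nhds ?_ ?_⟩
  · filter_upwards [hC] with i hi
    rw [inv_mul_eq_div]
    gcongr
    rw [le_log_iff_exp_le ((by positivity : (0 : ℝ) < _).trans_le hi), exp_sub,
      exp_log four_pos]
    exact hi
  · exact Eventually.of_forall fun i => mul_nonpos_of_nonneg_of_nonpos (by positivity)
      (log_nonpos measureReal_nonneg measureReal_le_one)

lemma exists_le_typeII : ∃ K ≥ (1 : ℝ), ∀ x : ι → ℝ,
    (∀ᶠ i in l, 2 * drift φ ϰ (e i) (S i) + K ≤ threshold ϰ (e i) (x i)) →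
      ∀ᶠ i in l, 1 - exp (-1) ≤ typeII P W φ ϰ (e i) (S i) (x i) := by
  obtain ⟨m₁, hm₁, m₂, hm₂, hA⟩ := hA2
  refine ⟨4 * m₂ + 1, by linarith, fun x hx => ?_⟩
  have hone : (fun _ => (1 : ℝ)) =O[l] R :=
    (isLittleO_const_left.2 (Or.inr (tendsto_norm_atTop_atTop.comp hR.tendsto_atTop))).isBigO
  filter_upwards [hR.eventually_pos, hx, hR.eventually_weight_mul_le hA1 hone]
    with i hpos hxi hweight
  obtain ⟨hA₁, hA₂⟩ := hA _ hpos
  refine le_trans ?_ (le_typeII hW hpos (hsum _ hpos) (hm₁.trans hA₁) zero_le_one hweight _)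
  gcongr
  linarith [drift_nonneg (φ := φ) (ϰ := ϰ) (ε := e i) (S := S i)]

theorem not_ldConsistent [l.NeBot] (hdrift : (fun i => drift φ ϰ (e i) (S i)) =o[l] R) :
    ¬ LDConsistent P W φ ϰ l e R S := by
  obtain ⟨K, hK, hβ⟩ := hR.exists_le_typeII (φ := φ) (S := S) hA1 hW hsum hA2
  set u : ι → ℝ := fun i => 2 * drift φ ϰ (e i) (S i) + K
  have hu : u =o[l] R := (hdrift.const_mul_left 2).add
    (isLittleO_const_left.2 (Or.inr (tendsto_norm_atTop_atTop.comp hR.tendsto_atTop)))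
  have hu₁ : ∀ i, 1 ≤ u i := fun i => by
    linarith [drift_nonneg (φ := φ) (ϰ := ϰ) (ε := e i) (S := S i)]
  set x : ι → ℝ := fun i => u i * e i ^ 2 / √(bigA ϰ (e i))
  have hx : ∀ᶠ i in l, threshold ϰ (e i) (x i) = u i := by
    obtain ⟨m₁, hm₁, m₂, -, hA⟩ := id hA2
    filter_upwards [hR.eventually_pos] with i hpos
    have hsqrt : √(bigA ϰ (e i)) ≠ 0 := (sqrt_pos.2 (hm₁.trans (hA _ hpos).1)).ne'
    simp only [threshold, x]
    field_simp
  intro hcons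
  obtain ⟨hα₀, hα⟩ := hR.tendsto_log_typeI (φ := φ) hA1 hW hsum hA2 (Eventually.of_forall hu₁) hu
    (hx.mono fun i hi => hi.le)
  obtain ⟨c, hc, hsmall⟩ := hcons x hα₀ hα
  have hlim : Tendsto (fun i => exp (-(c * R i ^ 2))) l (𝓝 0) :=
    tendsto_exp_neg_atTop_nhds_zero.comp
      (((tendsto_pow_atTop two_ne_zero).comp hR.tendsto_atTop).const_mul_atTop hc)
  have hpos : 0 < 1 - exp (-1) := sub_pos.2 (exp_lt_one_iff.2 (by norm_num))
  obtain ⟨i, hi, hiβ, hiexp⟩ := (hsmall.and ((hβ x (hx.mono fun i hi => hi.ge)).and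
    (hlim.eventually_lt_const hpos))).exists
  exact absurd (hiβ.trans hi) hiexp.not_ge

end IsCramerRate

end CramerZone

/-! ### Orders of magnitude of the coefficients -/

section Weights

variable {ϰ : ℝ → ℕ → ℝ} {ε : ℝ}

lemma tsum_sq_le_of_mul_le {f : ℕ → ℝ} (hf : ∀ j, 0 < j → 0 ≤ f j) {k : ℕ} (hk : k ≠ 0) {M : ℝ}
    (hM : ∀ j, 0 < j → f j ≤ M) (hdecay : ∀ j, k < j → j * f j ≤ k * M) :
    ∑' j : ℕ+, f j ^ 2 ≤ 2 * (k * M ^ 2) := by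
  rw [tsum_pnat_eq_tsum_succ (f := fun j => f j ^ 2)]
  refine tsum_le_of_sum_range_le (fun n => sq_nonneg _) fun N => ?_
  have hhead : ∑ j ∈ Finset.Ioc 0 k, f j ^ 2 ≤ k * M ^ 2 := by
    refine (Finset.sum_le_card_nsmul _ _ (M ^ 2) fun j hj => ?_).trans_eq (by simp)
    have hj := (Finset.mem_Ioc.1 hj).1
    exact pow_le_pow_left₀ (hf j hj) (hM j hj) 2
  have htail : ∑ j ∈ Finset.Ioc k (k + N), f j ^ 2 ≤ k * M ^ 2 :=
    calc ∑ j ∈ Finset.Ioc k (k + N), f j ^ 2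
      _ ≤ ∑ j ∈ Finset.Ioc k (k + N), (k * M) ^ 2 * ((j : ℝ) ^ 2)⁻¹ := by
        refine Finset.sum_le_sum fun j hj => ?_
        have hj := (Finset.mem_Ioc.1 hj).1
        have hj₀ : (0 : ℝ) < j := by exact_mod_cast hj.pos
        rw [← div_eq_mul_inv, le_div_iff₀ (by positivity), mul_comm, ← mul_pow]
        exact pow_le_pow_left₀ (mul_nonneg hj₀.le (hf j hj.pos)) (hdecay j hj) 2
      _ ≤ (k * M) ^ 2 * ((k : ℝ)⁻¹ - (↑(k + N))⁻¹) := by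
        rw [← Finset.mul_sum]
        gcongr
        exact sum_Ioc_inv_sq_le_sub hk (k.le_add_right N)
      _ ≤ (k * M) ^ 2 * (k : ℝ)⁻¹ := by
        gcongr
        exact sub_le_self _ (by positivity)
      _ = k * M ^ 2 := by field_simp
  calc ∑ i ∈ Finset.range N, f (i + 1) ^ 2 = ∑ j ∈ Finset.Ioc 0 N, f j ^ 2 := by
        rw [Finset.range_eq_Ico, Finset.sum_Ico_add' (fun j => f j ^ 2)]
        rfl
    _ ≤ ∑ j ∈ Finset.Ioc 0 (k + N), f j ^ 2 :=
      Finset.sum_le_sum_of_subset_of_nonneg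
        (Finset.Ioc_subset_Ioc_right (N.le_add_left k)) fun j _ _ => sq_nonneg _
    _ = ∑ j ∈ Finset.Ioc 0 k, f j ^ 2 + ∑ j ∈ Finset.Ioc k (k + N), f j ^ 2 :=
      (Finset.sum_Ioc_consecutive _ k.zero_le (k.le_add_right N)).symm
    _ ≤ 2 * (k * M ^ 2) := by linarith

lemma tsum_pow_four (hε : ε ≠ 0) : ∑' j : ℕ+, (ϰ ε j ^ 2) ^ 2 = ε ^ 4 * bigA ϰ ε := by
  rw [bigA, mul_inv_cancel_left₀ (by positivity)]
  exact tsum_congr fun j => by ring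

-- The junk value `k_ε = 0` of an unbounded `sSup` would make the left side of A3 independent of
-- `δ`, while its right side tends to `0` as `δ → ∞`.
lemma A3.kIdx_pos (hA3 : A3 ϰ) (hε : 0 < ε) : 0 < kIdx ϰ ε := by
  obtain ⟨C, -, lam, hlam, hdecay⟩ := hA3
  by_contra! hk
  have hlim : Tendsto (fun s : ℝ => C * s ^ (-lam)) atTop (𝓝 (C * 0)) :=
    (tendsto_rpow_neg_atTop (by linarith)).const_mul C
  rw [mul_zero] at hlim
  obtain ⟨s, hs, hs₁⟩ :=
    ((hlim.eventually_lt_const one_pos).and (eventually_gt_atTop 1)).exists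
  have hlt := hdecay (s - 1) (by linarith) ε hε
  rw [kappaSq, Nat.le_zero.1 hk] at hlt
  simp only [Nat.cast_zero, mul_zero, Nat.floor_zero, add_sub_cancel] at hlt
  nlinarith [sq_nonneg (ϰ ε 0)]

lemma kIdx_mul_kappaSq_sq_le (hA1 : A1 ϰ) (hε : 0 < ε) (hA : 0 < bigA ϰ ε) :
    kIdx ϰ ε * kappaSq ϰ ε ^ 2 ≤ ε ^ 4 * bigA ϰ ε := by
  have htsum := tsum_pow_four (ϰ := ϰ) hε.ne'
  have hsum : Summable fun j : ℕ+ => (ϰ ε j ^ 2) ^ 2 := by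
    by_contra hnot
    rw [tsum_eq_zero_of_not_summable hnot] at htsum
    exact (by positivity : (0 : ℝ) < ε ^ 4 * bigA ϰ ε).ne htsum
  rw [summable_pnat_iff_summable_succ (f := fun j => (ϰ ε j ^ 2) ^ 2)] at hsum
  rw [← htsum, tsum_pnat_eq_tsum_succ (f := fun j => (ϰ ε j ^ 2) ^ 2)]
  calc kIdx ϰ ε * kappaSq ϰ ε ^ 2 = ∑ _i ∈ Finset.range (kIdx ϰ ε), kappaSq ϰ ε ^ 2 := by simp
    _ ≤ ∑ i ∈ Finset.range (kIdx ϰ ε), (ϰ ε (i + 1) ^ 2) ^ 2 := by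
      refine Finset.sum_le_sum fun i hi => pow_le_pow_left₀ (sq_nonneg _) ?_ 2
      have hi : i + 1 ≤ kIdx ϰ ε := Finset.mem_range.1 hi
      exact hA1 ε hε (Set.mem_Ici.2 i.succ_pos) (Set.mem_Ici.2 (i.succ_pos.trans_le hi)) hi
    _ ≤ ∑' i, (ϰ ε (i + 1) ^ 2) ^ 2 := hsum.sum_le_tsum _ fun i _ => sq_nonneg _

lemma A3.exists_mul_sq_le (hA3 : A3 ϰ) : ∃ C > 0, ∀ ε > 0, ∀ j, kIdx ϰ ε < j →
    j * ϰ ε j ^ 2 ≤ kIdx ϰ ε * (C * kappaSq ϰ ε) := by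
  obtain ⟨C, hC, lam, hlam, hdecay⟩ := id hA3
  refine ⟨C, hC, fun ε hε j hj => ?_⟩
  have hk : (0 : ℝ) < kIdx ϰ ε := by exact_mod_cast hA3.kIdx_pos hε
  have hkj : (kIdx ϰ ε : ℝ) < j := by exact_mod_cast hj
  have hj₀ : (0 : ℝ) < j := hk.trans hkj
  have hlt := hdecay (j / kIdx ϰ ε - 1) (sub_pos.2 ((one_lt_div hk).2 hkj)) ε hε
  rw [add_sub_cancel, div_mul_cancel₀ _ hk.ne', Nat.floor_natCast] at hlt
  have hpow : ((j : ℝ) / kIdx ϰ ε) ^ (-lam) ≤ kIdx ϰ ε / j :=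
    calc ((j : ℝ) / kIdx ϰ ε) ^ (-lam) ≤ ((j : ℝ) / kIdx ϰ ε) ^ (-1 : ℝ) :=
          rpow_le_rpow_of_exponent_le ((one_lt_div hk).2 hkj).le (by linarith)
      _ = kIdx ϰ ε / j := by rw [rpow_neg_one, inv_div]
  have hκ : 0 ≤ kappaSq ϰ ε := sq_nonneg _
  calc j * ϰ ε j ^ 2 ≤ j * (C * ((j : ℝ) / kIdx ϰ ε) ^ (-lam) * kappaSq ϰ ε) := by gcongr
    _ ≤ j * (C * (kIdx ϰ ε / j) * kappaSq ϰ ε) := by gcongr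
    _ = kIdx ϰ ε * (C * kappaSq ϰ ε) := by field_simp

lemma kIdx_mul_kappaSq_sq_isTheta (hA1 : A1 ϰ) (hA2 : A2 ϰ) (hA3 : A3 ϰ) (hA4 : A4 ϰ) :
    (fun ε => kIdx ϰ ε * kappaSq ϰ ε ^ 2) =Θ[𝓝[>] 0] fun ε => ε ^ 4 := by
  obtain ⟨m₁, hm₁, m₂, -, hA⟩ := hA2
  obtain ⟨B, -, hfirst⟩ := hA4.1.1.exists_pos
  obtain ⟨C, -, hdecay⟩ := hA3.exists_mul_sq_le
  refine ⟨IsBigO.of_bound m₂ ?_, IsBigO.of_bound (2 * max B C ^ 2 / m₁) ?_⟩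
  · filter_upwards [self_mem_nhdsWithin] with ε (hε : 0 < ε)
    obtain ⟨hA₁, hA₂⟩ := hA ε hε
    rw [norm_of_nonneg (by positivity), norm_of_nonneg (by positivity), mul_comm m₂]
    refine (kIdx_mul_kappaSq_sq_le hA1 hε (hm₁.trans hA₁)).trans ?_
    gcongr
  · filter_upwards [hfirst.bound, self_mem_nhdsWithin] with ε hfirstε (hε : 0 < ε)
    have hκ : 0 ≤ kappaSq ϰ ε := sq_nonneg _
    rw [norm_of_nonneg (sq_nonneg _), norm_of_nonneg hκ] at hfirstε
    have htsum := tsum_sq_le_of_mul_le (f := fun j => ϰ ε j ^ 2) (M := max B C * kappaSq ϰ ε)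
      (fun j _ => sq_nonneg _) (hA3.kIdx_pos hε).ne' ?_ ?_
    · rw [tsum_pow_four hε.ne'] at htsum
      rw [norm_of_nonneg (by positivity), norm_of_nonneg (by positivity), div_mul_eq_mul_div,
        le_div_iff₀ hm₁]
      calc ε ^ 4 * m₁ ≤ ε ^ 4 * bigA ϰ ε := by
            gcongr
            exact (hA ε hε).1.le
        _ ≤ 2 * (kIdx ϰ ε * (max B C * kappaSq ϰ ε) ^ 2) := htsum
        _ = 2 * max B C ^ 2 * (kIdx ϰ ε * kappaSq ϰ ε ^ 2) := by ring
    · intro j hj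
      refine (hA1 ε hε Set.self_mem_Ici hj hj).trans (hfirstε.trans ?_)
      gcongr
      exact le_max_left B C
    · intro j hj
      refine (hdecay ε hε j hj).trans ?_
      gcongr
      exact le_max_right B C

section Rates

variable {r w : ℝ}
  (hk : (fun ε => (kIdx ϰ ε : ℝ)) =Θ[𝓝[>] (0 : ℝ)] fun ε => ε ^ (-4 + 8 * r + 4 * w))
  (hA1 : A1 ϰ) (hA2 : A2 ϰ) (hA3 : A3 ϰ) (hA4 : A4 ϰ)
include hk hA1 hA2 hA3 hA4

lemma kappaSq_isTheta :
    (fun ε => kappaSq ϰ ε) =Θ[𝓝[>] 0] fun ε => ε ^ (4 - 4 * r - 2 * w) := by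
  have hleft : (fun ε => kIdx ϰ ε * kappaSq ϰ ε ^ 2 / kIdx ϰ ε) =ᶠ[𝓝[>] 0]
      (fun ε => kappaSq ϰ ε) ^ 2 := by
    filter_upwards [self_mem_nhdsWithin] with ε hε
    exact mul_div_cancel_left₀ _ (Nat.cast_ne_zero.2 (hA3.kIdx_pos hε).ne')
  have hright : (fun ε : ℝ => ε ^ 4 / ε ^ (-4 + 8 * r + 4 * w)) =ᶠ[𝓝[>] 0]
      (fun ε => ε ^ (4 - 4 * r - 2 * w)) ^ 2 := by
    filter_upwards [self_mem_nhdsWithin] with ε (hε : 0 < ε)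
    rw [Pi.pow_apply, ← rpow_natCast, ← rpow_natCast, ← rpow_sub hε, ← rpow_mul hε.le]
    congr 1
    push_cast
    ring
  have hsq := hleft.symm.trans_isTheta
    (((kIdx_mul_kappaSq_sq_isTheta hA1 hA2 hA3 hA4).div hk).trans_eventuallyEq hright)
  exact ⟨hsq.1.of_pow two_ne_zero, hsq.2.of_pow two_ne_zero⟩

lemma kappaSq_div_mul_sq_isTheta :
    (fun ε => kappaSq ϰ ε / ε ^ 4 * (ε ^ (2 * r)) ^ 2) =Θ[𝓝[>] 0] fun ε => ε ^ (-2 * w) := by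
  refine (((kappaSq_isTheta hk hA1 hA2 hA3 hA4).div (isTheta_refl (fun ε : ℝ => ε ^ 4) _)).mul
    (isTheta_refl (fun ε : ℝ => (ε ^ (2 * r)) ^ 2) _)).trans_eventuallyEq ?_
  filter_upwards [self_mem_nhdsWithin] with ε (hε : 0 < ε)
  rw [← rpow_natCast ε, ← rpow_natCast (ε ^ (2 * r)), ← rpow_sub hε, ← rpow_mul hε.le,
    ← rpow_add hε]
  congr 1
  push_cast
  ring

lemma isCramerRate (hw₀ : 0 < 2 * w) (hw₁ : 2 * w < 1 - 2 * r) :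
    IsCramerRate ϰ (𝓝[>] 0) (fun ε => ε) fun ε => ε ^ (-2 * w) where
  eventually_pos := self_mem_nhdsWithin
  tendsto_atTop := tendsto_rpow_neg_nhdsGT_zero (by linarith)
  tendsto_weight := by
    have hlim : Tendsto (fun ε : ℝ => ε ^ (2 - 4 * r - 4 * w)) (𝓝[>] 0) (𝓝 0) := by
      have h := (continuousAt_rpow_const 0 (2 - 4 * r - 4 * w) (.inr (by linarith))).tendsto
      rw [zero_rpow (by linarith)] at h
      exact h.mono_left nhdsWithin_le_nhds
    refine (((((hA4.1.trans (kappaSq_isTheta hk hA1 hA2 hA3 hA4)).div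
      (isTheta_refl (fun ε : ℝ => ε ^ 2) _)).mul
      (isTheta_refl (fun ε : ℝ => ε ^ (-2 * w)) _)).trans_eventuallyEq ?_).1).trans_tendsto hlim
    filter_upwards [self_mem_nhdsWithin] with ε (hε : 0 < ε)
    rw [← rpow_natCast, ← rpow_sub hε, ← rpow_add hε]
    congr 1
    push_cast
    ring

end Rates

end Weights

/-! ### Tails of a signal -/

section Tails

section CoordinateProjection

variable {ι 𝕜 E : Type*} [RCLike 𝕜] [NormedAddCommGroup E] [InnerProductSpace 𝕜 E]

open scoped InnerProductSpace

lemma norm_sq_le_of_inner_sub_eq_zero (K : Submodule 𝕜 E) [K.HasOrthogonalProjection] {x y : E}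
    (hxy : ⟪x, y - x⟫_𝕜 = 0) (hy : ‖K.starProjection y‖ ≤ ‖x‖ / 2) :
    ‖x‖ ^ 2 ≤ 2 * (‖x - K.starProjection x‖ * ‖y‖) := by
  have hnorm : ‖x‖ ^ 2 = ‖⟪x, y⟫_𝕜‖ := by
    rw [← sub_add_cancel y x, inner_add_right, hxy, zero_add,
      inner_self_eq_norm_sq_to_K, norm_pow, norm_algebraMap', norm_norm]
  have hsplit : ⟪x, y⟫_𝕜 = ⟪x - K.starProjection x, y⟫_𝕜 + ⟪x, K.starProjection y⟫_𝕜 := by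
    rw [← K.inner_starProjection_left_eq_right, ← inner_add_left, sub_add_cancel]
  have hle : ‖x‖ ^ 2 ≤ ‖x - K.starProjection x‖ * ‖y‖ + ‖x‖ * (‖x‖ / 2) :=
    calc ‖x‖ ^ 2 ≤ ‖⟪x - K.starProjection x, y⟫_𝕜‖ + ‖⟪x, K.starProjection y⟫_𝕜‖ := by
          rw [hnorm, hsplit]
          exact norm_add_le _ _
      _ ≤ ‖x - K.starProjection x‖ * ‖y‖ + ‖x‖ * ‖K.starProjection y‖ :=
          add_le_add (norm_inner_le_norm _ _) (norm_inner_le_norm _ _)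
      _ ≤ _ := by gcongr
  linarith

variable [CompleteSpace E] (b : HilbertBasis ι 𝕜 E)

/-- The orthogonal projection onto the coordinates of the Hilbert basis `b` with index in `s`,
that is, onto the closed span of the corresponding basis vectors. -/
noncomputable def coordProj (s : Set ι) : E →L[𝕜] E :=
  (Submodule.span 𝕜 (b '' s)).topologicalClosure.starProjection

lemma inner_coordProj (s : Set ι) (x : E) (i : ι) :
    ⟪b i, coordProj b s x⟫_𝕜 = s.indicator (fun i => ⟪b i, x⟫_𝕜) i := by
  rw [coordProj, ← Submodule.inner_starProjection_left_eq_right]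
  by_cases hi : i ∈ s
  · have hmem : b i ∈ (Submodule.span 𝕜 (b '' s)).topologicalClosure :=
      Submodule.le_topologicalClosure _ (Submodule.subset_span (Set.mem_image_of_mem b hi))
    rw [Submodule.starProjection_eq_self_iff.2 hmem, Set.indicator_of_mem hi]
  · have hortho : Submodule.span 𝕜 {b i} ⟂ Submodule.span 𝕜 (b '' s) := by
      rw [Submodule.isOrtho_span]
      rintro _ rfl _ ⟨j, hj, rfl⟩
      exact b.orthonormal.2 (ne_of_mem_of_not_mem hj hi).symm
    have hmem : b i ∈ (Submodule.span 𝕜 (b '' s)).topologicalClosureᗮ := by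
      rw [Submodule.orthogonal_closure]
      exact hortho (Submodule.mem_span_singleton_self _)
    rw [(Submodule.starProjection_apply_eq_zero_iff _).2 hmem, inner_zero_left,
      Set.indicator_of_notMem hi]

lemma norm_coordProj_le_of_subset {s t : Set ι} (hst : s ⊆ t) (x : E) :
    ‖coordProj b s x‖ ≤ ‖coordProj b t x‖ := by
  have hle := Submodule.topologicalClosure_mono (Submodule.span_mono (R := 𝕜)
    (Set.image_mono (f := b) hst))
  rw [coordProj, ← Submodule.starProjection_comp_starProjection_of_le hle]
  exact Submodule.norm_starProjection_apply_le _ _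

end CoordinateProjection

variable {φ : HilbertBasis ℕ+ ℝ L2} {ϰ : ℝ → ℕ → ℝ} {ε c : ℝ}

/-- The tail of a signal: its projection onto the coordinates with index `j > c`. -/
noncomputable def tailProj (φ : HilbertBasis ℕ+ ℝ L2) (c : ℝ) : L2 →L[ℝ] L2 :=
  coordProj φ {j | c < (j : ℕ)}

lemma fourier_tailProj (c : ℝ) (S : L2) (j : ℕ+) :
    fourier φ (tailProj φ c S) j = {j : ℕ+ | c < (j : ℕ)}.indicator (fourier φ S) j :=
  inner_coordProj φ _ S j

lemma norm_sq_tailProj (φ : HilbertBasis ℕ+ ℝ L2) (c : ℝ) (S : L2) :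
    ‖tailProj φ c S‖ ^ 2 = ∑' j : {j : ℕ+ // c < (j : ℕ)}, |fourier φ S j| ^ 2 := by
  rw [← (hasSum_fourier_sq φ _).tsum_eq]
  refine Eq.trans ?_ (tsum_subtype {j : ℕ+ | c < (j : ℕ)} fun j => |fourier φ S j| ^ 2).symm
  refine tsum_congr fun j => ?_
  by_cases hj : c < (j : ℕ) <;> simp [fourier_tailProj, hj]

lemma norm_tailProj_anti (φ : HilbertBasis ℕ+ ℝ L2) (S : L2) :
    Antitone fun c => ‖tailProj φ c S‖ :=
  fun _ _ hc => norm_coordProj_le_of_subset φ (fun _ hj => hc.trans_lt hj) S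

lemma inner_tailProj_sub (S : L2) : inner ℝ (tailProj φ c S) (S - tailProj φ c S) = 0 := by
  rw [real_inner_comm]
  exact Submodule.starProjection_inner_eq_zero _ _ (Submodule.starProjection_apply_mem _ _)

section Drift

variable (hA1 : A1 ϰ) (hε : 0 < ε) (hsum : Summable fun j : ℕ+ => ϰ ε j ^ 2)
include hA1 hε hsum

lemma mul_norm_sq_sub_tailProj_le_drift (S : L2) :
    ϰ ε ⌊c⌋₊ ^ 2 / ε ^ 4 * ‖S - tailProj φ c S‖ ^ 2 ≤ drift φ ϰ ε S := by
  have hfourier : ∀ j, fourier φ (S - tailProj φ c S) j =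
      fourier φ S j - {j : ℕ+ | c < (j : ℕ)}.indicator (fourier φ S) j := fun j => by
    rw [← fourier_tailProj, fourier, inner_sub_right, fourier, fourier]
  rw [div_mul_eq_mul_div, div_eq_inv_mul, drift]
  gcongr
  refine hasSum_le (fun j => ?_) ((hasSum_fourier_sq φ _).mul_left _)
    (summable_mul_fourier_sq hsum).hasSum
  by_cases hj : c < (j : ℕ)
  · simpa [hfourier, hj] using by positivity
  · have hle : (j : ℕ) ≤ ⌊c⌋₊ := Nat.le_floor (not_lt.1 hj)
    simp only [hfourier, Set.mem_ofPred_eq, hj, not_false_eq_true, Set.indicator_of_notMem,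
      sub_zero]
    exact mul_le_mul_of_nonneg_right
      (hA1 ε hε (Set.mem_Ici.2 j.pos) (Set.mem_Ici.2 (j.pos.trans_le hle)) hle) (sq_nonneg _)

lemma drift_tailProj_le (hc : 1 ≤ c) (S : L2) :
    drift φ ϰ ε (tailProj φ c S) ≤ ϰ ε ⌊c⌋₊ ^ 2 / ε ^ 4 * ‖S‖ ^ 2 := by
  rw [div_mul_eq_mul_div, div_eq_inv_mul, drift]
  gcongr
  refine hasSum_le (fun j => ?_) (summable_mul_fourier_sq hsum).hasSum
    ((hasSum_fourier_sq φ S).mul_left _)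
  by_cases hj : c < (j : ℕ)
  · simp only [fourier_tailProj, Set.mem_ofPred_eq, hj, Set.indicator_of_mem]
    exact mul_le_mul_of_nonneg_right (hA1 ε hε (Set.mem_Ici.2 ((Nat.one_le_floor_iff c).2 hc))
      (Set.mem_Ici.2 j.pos) (Nat.floor_le_of_le hj.le)) (sq_nonneg _)
  · simpa [fourier_tailProj, hj] using by positivity

end Drift

end Tails

/-! ### Purely consistent families -/

section Purity

variable {Ω ι : Type*} [MeasurableSpace Ω] {P : Measure Ω} [IsProbabilityMeasure P]
  {W : L2 → Ω → ℝ} {φ : HilbertBasis ℕ+ ℝ L2} {ϰ : ℝ → ℕ → ℝ} {r w : ℝ} {S : ℝ → L2}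

/-- The tails of the family `S` beyond large multiples of `k_ε` have norm at most an arbitrarily
small multiple of `ε^{2r}`; this is the condition of the theorem, in terms of norms instead of
their squares. -/
def HasNegligibleTails (φ : HilbertBasis ℕ+ ℝ L2) (ϰ : ℝ → ℕ → ℝ) (r : ℝ) (S : ℝ → L2) : Prop :=
  ∀ δ > (0 : ℝ), ∃ C > (0 : ℝ), ∀ᶠ ε in 𝓝[>] (0 : ℝ),
    ‖tailProj φ (C * kIdx ϰ ε) (S ε)‖ ≤ δ * ε ^ (2 * r)

lemma hasNegligibleTails_iff : HasNegligibleTails φ ϰ r S ↔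
    ∀ δ > (0 : ℝ), ∃ C₁ > (0 : ℝ), ∃ ε₀ > (0 : ℝ), ∀ ε : ℝ, 0 < ε → ε < ε₀ →
      ∑' j : {j : ℕ+ // C₁ * (kIdx ϰ ε : ℝ) < (j : ℕ)}, |fourier φ (S ε) j| ^ 2 ≤
        δ * ε ^ (4 * r) := by
  have hsq : ∀ {δ ε C : ℝ}, 0 < δ → 0 < ε →
      (∑' j : {j : ℕ+ // C * (kIdx ϰ ε : ℝ) < (j : ℕ)}, |fourier φ (S ε) j| ^ 2 ≤
        δ * ε ^ (4 * r) ↔ ‖tailProj φ (C * kIdx ϰ ε) (S ε)‖ ≤ √δ * ε ^ (2 * r)) := by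
    intro δ ε C hδ hε
    have hpow : δ * ε ^ (4 * r) = (√δ * ε ^ (2 * r)) ^ 2 := by
      rw [mul_pow, sq_sqrt hδ.le, ← rpow_mul_natCast hε.le]
      congr 2
      push_cast
      ring
    rw [← norm_sq_tailProj, hpow, sq_le_sq₀ (norm_nonneg _) (by positivity)]
  have heventually : ∀ {δ C : ℝ}, 0 < δ →
      ((∀ᶠ ε in 𝓝[>] (0 : ℝ), ‖tailProj φ (C * kIdx ϰ ε) (S ε)‖ ≤ √δ * ε ^ (2 * r)) ↔
        ∃ ε₀ > (0 : ℝ), ∀ ε : ℝ, 0 < ε → ε < ε₀ →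
          ∑' j : {j : ℕ+ // C * (kIdx ϰ ε : ℝ) < (j : ℕ)}, |fourier φ (S ε) j| ^ 2 ≤
            δ * ε ^ (4 * r)) := by
    intro δ C hδ
    rw [Filter.Eventually, mem_nhdsGT_iff_exists_Ioo_subset]
    refine exists_congr fun ε₀ => and_congr_right fun _ => forall_congr' fun ε => ?_
    exact ⟨fun h hε hε₀ => (hsq hδ hε).2 (h ⟨hε, hε₀⟩),
      fun h hε => (hsq hδ hε.1).1 (h hε.1 hε.2)⟩
  refine ⟨fun h δ hδ => ?_, fun h δ hδ => ?_⟩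
  · obtain ⟨C, hC, htail⟩ := h (√δ) (sqrt_pos.2 hδ)
    exact ⟨C, hC, (heventually hδ).1 htail⟩
  · obtain ⟨C, hC, htail⟩ := h (δ ^ 2) (by positivity)
    refine ⟨C, hC, ?_⟩
    simpa only [sqrt_sq hδ.le] using (heventually (by positivity)).2 htail

section Parts

variable {l : Filter ι} {e : ι → ℝ} {S₁ : ι → L2}

lemma HasNegligibleTails.exists_isBigO_norm_sub_tailProj (htail : HasNegligibleTails φ ϰ r S)
    (hS : (fun ε => ‖S ε‖) =O[𝓝[>] (0 : ℝ)] fun ε => ε ^ (2 * r)) (he : Tendsto e l (𝓝[>] 0))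
    (hS₁ : (fun i => e i ^ (2 * r)) =O[l] fun i => ‖S₁ i‖)
    (horth : ∀ i, inner ℝ (S₁ i) (S (e i) - S₁ i) = 0) :
    ∃ C > (1 : ℝ), (fun i => e i ^ (2 * r)) =O[l]
      fun i => ‖S₁ i - tailProj φ (C * kIdx ϰ (e i)) (S₁ i)‖ := by
  obtain ⟨a, ha, hlower⟩ := hS₁.exists_pos
  obtain ⟨b, -, hupper⟩ := hS.exists_pos
  obtain ⟨C, -, htail⟩ := htail (1 / (2 * a)) (by positivity)
  refine ⟨max C 2, lt_max_of_lt_right one_lt_two, IsBigO.of_bound (2 * b * a ^ 2) ?_⟩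
  filter_upwards [hlower.bound, he.eventually hupper.bound, he.eventually htail,
    he.eventually self_mem_nhdsWithin] with i hlower hupper htail (hε : 0 < e i)
  have hη : 0 < e i ^ (2 * r) := rpow_pos_of_pos hε _
  rw [norm_of_nonneg hη.le, norm_norm] at hlower hupper ⊢
  have htail' : ‖tailProj φ (max C 2 * kIdx ϰ (e i)) (S (e i))‖ ≤ ‖S₁ i‖ / 2 :=
    calc ‖tailProj φ (max C 2 * kIdx ϰ (e i)) (S (e i))‖
      _ ≤ ‖tailProj φ (C * kIdx ϰ (e i)) (S (e i))‖ :=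
        norm_tailProj_anti φ _ (by gcongr; exact le_max_left C 2)
      _ ≤ 1 / (2 * a) * (a * ‖S₁ i‖) := htail.trans (by gcongr)
      _ = ‖S₁ i‖ / 2 := by field_simp
  have hhead := norm_sq_le_of_inner_sub_eq_zero _ (horth i) htail'
  refine le_of_mul_le_mul_right ?_ hη
  calc e i ^ (2 * r) * e i ^ (2 * r) ≤ (a * ‖S₁ i‖) * (a * ‖S₁ i‖) := by gcongr
    _ = a ^ 2 * ‖S₁ i‖ ^ 2 := by ring
    _ ≤ a ^ 2 * (2 * (‖S₁ i - tailProj φ (max C 2 * kIdx ϰ (e i)) (S₁ i)‖ *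
          (b * e i ^ (2 * r)))) := by
      gcongr
      exact hhead.trans (by gcongr; rfl)
    _ = _ := by ring

lemma HasNegligibleTails.isBigO_drift (htail : HasNegligibleTails φ ϰ r S)
    (hS : (fun ε => ‖S ε‖) =O[𝓝[>] (0 : ℝ)] fun ε => ε ^ (2 * r))
    (hsum : ∀ ε > 0, Summable fun j : ℕ+ => ϰ ε j ^ 2) (hA1 : A1 ϰ) (hA4 : A4 ϰ)
    (he : Tendsto e l (𝓝[>] 0)) (hS₁ : (fun i => e i ^ (2 * r)) =O[l] fun i => ‖S₁ i‖)
    (horth : ∀ i, inner ℝ (S₁ i) (S (e i) - S₁ i) = 0) :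
    (fun i => kappaSq ϰ (e i) / e i ^ 4 * (e i ^ (2 * r)) ^ 2) =O[l]
      fun i => drift φ ϰ (e i) (S₁ i) := by
  obtain ⟨C, hC, hhead⟩ := htail.exists_isBigO_norm_sub_tailProj hS he hS₁ horth
  obtain ⟨a, ha, hA4⟩ := hA4.2 C hC
  have hε : ∀ᶠ i in l, 0 < e i := he.eventually self_mem_nhdsWithin
  have hweight : (fun i => kappaSq ϰ (e i) / e i ^ 4) =O[l]
      fun i => ϰ (e i) ⌊C * (kIdx ϰ (e i) : ℝ)⌋₊ ^ 2 / e i ^ 4 := by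
    refine IsBigO.mul (IsBigO.of_bound a⁻¹ ?_) (isBigO_refl _ _)
    filter_upwards [hε] with i hε
    have hκ : 0 ≤ kappaSq ϰ (e i) := sq_nonneg _
    rw [norm_of_nonneg hκ, norm_of_nonneg (sq_nonneg _), le_inv_mul_iff₀ ha]
    exact hA4 _ hε
  refine (hweight.mul (hhead.pow 2)).trans (IsBigO.of_norm_eventuallyLE ?_)
  filter_upwards [hε] with i hε
  rw [norm_of_nonneg (by positivity)]
  exact mul_norm_sq_sub_tailProj_le_drift hA1 hε (hsum _ hε) _

end Parts

section Consistency

variable (hsum : ∀ ε > 0, Summable fun j : ℕ+ => ϰ ε j ^ 2)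
  (hA1 : A1 ϰ) (hA2 : A2 ϰ) (hA3 : A3 ϰ) (hA4 : A4 ϰ)
  (hk : (fun ε => (kIdx ϰ ε : ℝ)) =Θ[𝓝[>] (0 : ℝ)] fun ε => ε ^ (-4 + 8 * r + 4 * w))
  (hS : (fun ε => ‖S ε‖) =O[𝓝[>] (0 : ℝ)] fun ε => ε ^ (2 * r))
include hsum hA1 hA2 hA3 hA4 hk hS

lemma isLittleO_drift_tailProj {e : ℕ → ℝ} (he : Tendsto e atTop (𝓝[>] 0)) :
    (fun i => drift φ ϰ (e i) (tailProj φ ((i + 2) * kIdx ϰ (e i)) (S (e i)))) =o[atTop]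
      fun i => e i ^ (-2 * w) := by
  obtain ⟨D, -, lam, hlam, hdecay⟩ := id hA3
  have hlim : Tendsto (fun i : ℕ => D * ((i : ℝ) + 2) ^ (-lam)) atTop (𝓝 0) := by
    simpa using ((tendsto_rpow_neg_atTop (zero_lt_one.trans hlam)).comp
      (tendsto_atTop_add_const_right atTop (2 : ℝ) tendsto_natCast_atTop_atTop)).const_mul D
  have hrate := ((((isBigO_refl (fun ε => kappaSq ϰ ε / ε ^ 4) _).mul (hS.pow 2)).trans
    (kappaSq_div_mul_sq_isTheta hk hA1 hA2 hA3 hA4).1).comp_tendsto he)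
  have hsmall := ((isLittleO_one_iff ℝ).2 hlim).mul_isBigO hrate
  simp only [one_mul] at hsmall
  refine IsBigO.trans_isLittleO (IsBigO.of_norm_eventuallyLE ?_) hsmall
  filter_upwards [he.eventually self_mem_nhdsWithin] with i (hε : 0 < e i)
  have hkIdx : (1 : ℝ) ≤ kIdx ϰ (e i) := by exact_mod_cast hA3.kIdx_pos hε
  have hfar := hdecay (i + 1) (by positivity) (e i) hε
  rw [show 1 + ((i : ℝ) + 1) = i + 2 by ring] at hfar
  rw [norm_of_nonneg drift_nonneg]
  calc drift φ ϰ (e i) (tailProj φ ((i + 2) * kIdx ϰ (e i)) (S (e i)))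
    _ ≤ ϰ (e i) ⌊((i : ℝ) + 2) * kIdx ϰ (e i)⌋₊ ^ 2 / e i ^ 4 * ‖S (e i)‖ ^ 2 :=
      drift_tailProj_le hA1 hε (hsum _ hε) (by nlinarith [i.cast_nonneg (α := ℝ)]) _
    _ ≤ D * ((i : ℝ) + 2) ^ (-lam) * kappaSq ϰ (e i) / e i ^ 4 * ‖S (e i)‖ ^ 2 := by gcongr
    _ = D * ((i : ℝ) + 2) ^ (-lam) * (kappaSq ϰ (e i) / e i ^ 4 * ‖S (e i)‖ ^ 2) := by ring

variable (hW : IsWhiteNoise P W) (hw₀ : 0 < 2 * w) (hw₁ : 2 * w < 1 - 2 * r)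
include hW hw₀ hw₁

theorem HasNegligibleTails.ldConsistent (htail : HasNegligibleTails φ ϰ r S) {l : Filter ι}
    {e : ι → ℝ} (he : Tendsto e l (𝓝[>] 0)) {S₁ : ι → L2}
    (hS₁ : (fun i => e i ^ (2 * r)) =O[l] fun i => ‖S₁ i‖)
    (horth : ∀ i, inner ℝ (S₁ i) (S (e i) - S₁ i) = 0) :
    LDConsistent P W φ ϰ l e (fun i => e i ^ (-2 * w)) S₁ :=
  ((isCramerRate hk hA1 hA2 hA3 hA4 hw₀ hw₁).comp he).ldConsistent hA1 hW hsum hA2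
    (((kappaSq_div_mul_sq_isTheta hk hA1 hA2 hA3 hA4).2.comp_tendsto he).trans
      (htail.isBigO_drift hS hsum hA1 hA4 he hS₁ horth))

theorem exists_inconsistent_of_not_hasNegligibleTails (htail : ¬ HasNegligibleTails φ ϰ r S) :
    ∃ (e : ℕ → ℝ) (S₁ : ℕ → L2),
      (∀ i, 0 < e i) ∧ Tendsto e atTop (𝓝 0) ∧
      (∃ c₁ > 0, ∀ i, c₁ * e i ^ (2 * r) < ‖S₁ i‖) ∧
      (∀ i, inner ℝ (S₁ i) (S (e i) - S₁ i) = 0) ∧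
      ¬ LDConsistent P W φ ϰ atTop e (fun i => e i ^ (-2 * w)) S₁ := by
  simp only [HasNegligibleTails, not_forall, not_exists, not_and, not_eventually, not_le] at htail
  obtain ⟨δ, hδ, hlarge⟩ := htail
  choose e hlarge he_mem using fun i : ℕ => ((hlarge (i + 2) (by positivity)).and_eventually
    (Ioo_mem_nhdsGT (Nat.one_div_pos_of_nat (n := i)))).exists
  have he₀ : Tendsto e atTop (𝓝 0) := squeeze_zero (fun i => (he_mem i).1.le)
    (fun i => (he_mem i).2.le) tendsto_one_div_add_atTop_nhds_zero_nat
  have he : Tendsto e atTop (𝓝[>] 0) :=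
    tendsto_nhdsWithin_iff.2 ⟨he₀, .of_forall fun i => (he_mem i).1⟩
  exact ⟨e, fun i => tailProj φ ((i + 2) * kIdx ϰ (e i)) (S (e i)), fun i => (he_mem i).1, he₀,
    ⟨δ, hδ, hlarge⟩, fun i => inner_tailProj_sub _,
    ((isCramerRate hk hA1 hA2 hA3 hA4 hw₀ hw₁).comp he).not_ldConsistent hA1 hW hsum hA2
      (isLittleO_drift_tailProj hsum hA1 hA2 hA3 hA4 hk hS he)⟩

end Consistency

end Purity

end SignalDetection

theorem mainTheorem4_general
    {Ω : Type*} [MeasurableSpace Ω] (P : Measure Ω) [IsProbabilityMeasure P]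
    (W : SignalDetection.L2 → Ω → ℝ) (hW : SignalDetection.IsWhiteNoise P W)
    (φ : HilbertBasis ℕ+ ℝ SignalDetection.L2)
    (r w : ℝ) (hw₀ : 0 < 2 * w) (hw₁ : 2 * w < 1 - 2 * r)
    (ϰ : ℝ → ℕ → ℝ)
    (hsum : ∀ ε > 0, Summable fun j : ℕ+ => ϰ ε j ^ 2)
    (hA1 : SignalDetection.A1 ϰ) (hA2 : SignalDetection.A2 ϰ)
    (hA3 : SignalDetection.A3 ϰ) (hA4 : SignalDetection.A4 ϰ)
    (hk : (fun ε => (SignalDetection.kIdx ϰ ε : ℝ)) =Θ[𝓝[>] (0 : ℝ)]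
      fun ε => ε ^ (-4 + 8 * r + 4 * w))
    (S : ℝ → SignalDetection.L2)
    (hS : (fun ε => ‖S ε‖) =Θ[𝓝[>] (0 : ℝ)] fun ε => ε ^ (2 * r)) :
    SignalDetection.PurelyLDConsistent P W φ ϰ r w S ↔
      ∀ δ > (0 : ℝ), ∃ C₁ > (0 : ℝ), ∃ ε₀ > (0 : ℝ), ∀ ε : ℝ, 0 < ε → ε < ε₀ →
        ∑' j : {j : ℕ+ // C₁ * (SignalDetection.kIdx ϰ ε : ℝ) < (j : ℕ)},
          |SignalDetection.fourier φ (S ε) j| ^ 2 ≤ δ * ε ^ (4 * r) := by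
  rw [← SignalDetection.hasNegligibleTails_iff]
  constructor
  · rintro ⟨-, hpure⟩
    by_contra htail
    exact hpure (SignalDetection.exists_inconsistent_of_not_hasNegligibleTails hsum hA1 hA2
      hA3 hA4 hk hS.1 hW hw₀ hw₁ htail)
  · intro htail
    refine ⟨htail.ldConsistent hsum hA1 hA2 hA3 hA4 hk hS.1 hW hw₀ hw₁ tendsto_id hS.2
      fun ε => by rw [id, sub_self, inner_zero_right], ?_⟩
    rintro ⟨e, S₁, he_pos, he₀, ⟨c₁, hc₁, hlower⟩, horth, hnot⟩
    refine hnot (htail.ldConsistent hsum hA1 hA2 hA3 hA4 hk hS.1 hW hw₀ hw₁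
      (tendsto_nhdsWithin_iff.2 ⟨he₀, .of_forall he_pos⟩) (IsBigO.of_bound c₁⁻¹ ?_) horth)
    filter_upwards with i
    rw [Real.norm_of_nonneg (Real.rpow_nonneg (he_pos i).le _), norm_norm, le_inv_mul_iff₀ hc₁]
    exact (hlower i).le

theorem mainTheorem4
    {Ω : Type*} [MeasurableSpace Ω] (P : Measure Ω) [IsProbabilityMeasure P]
    (W : SignalDetection.L2 → Ω → ℝ) (hW : SignalDetection.IsWhiteNoise P W)
    (φ : HilbertBasis ℕ+ ℝ SignalDetection.L2)
    (r w : ℝ) (hr₀ : 0 < r) (hr₁ : r < 1 / 2) (hw₀ : 0 < 2 * w) (hw₁ : 2 * w < 1 - 2 * r)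
    (ϰ : ℝ → ℕ → ℝ)
    (hsum : ∀ ε > 0, Summable fun j : ℕ+ => ϰ ε j ^ 2)
    (hA1 : SignalDetection.A1 ϰ) (hA2 : SignalDetection.A2 ϰ)
    (hA3 : SignalDetection.A3 ϰ) (hA4 : SignalDetection.A4 ϰ)
    (hk : (fun ε => (SignalDetection.kIdx ϰ ε : ℝ)) =Θ[𝓝[>] (0 : ℝ)]
      fun ε => ε ^ (-4 + 8 * r + 4 * w))
    (S : ℝ → SignalDetection.L2)
    (hS : (fun ε => ‖S ε‖) =Θ[𝓝[>] (0 : ℝ)] fun ε => ε ^ (2 * r)) :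
    SignalDetection.PurelyLDConsistent P W φ ϰ r w S ↔
      ∀ δ > (0 : ℝ), ∃ C₁ > (0 : ℝ), ∃ ε₀ > (0 : ℝ), ∀ ε : ℝ, 0 < ε → ε < ε₀ →
        ∑' j : {j : ℕ+ // C₁ * (SignalDetection.kIdx ϰ ε : ℝ) < (j : ℕ)},
          |SignalDetection.fourier φ (S ε) j| ^ 2 ≤ δ * ε ^ (4 * r) :=
  mainTheorem4_general P W hW φ r w hw₀ hw₁ ϰ hsum hA1 hA2 hA3 hA4 hk S hS
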